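/- Let $k$ be an algebraically closed field of characteristic $0$ and let $k\langle x_1,\dots,x_g\rangle$ be the free $k$-algebra. For $n\ge 1$ let $X^{(n)}=(X^{(n)}_1,\dots,X^{(n)}_g)$ be a tuple of generic $n\times n$ matrices, i.e. the $gn^2$ entries of these matrices are independent commuting variables. A nonconstant $f\in k\langle x_1,\dots,x_g\rangle$ is called an atom if it is not a product of two nonconstant elements of $k\langle x_1,\dots,x_g\rangle$. A matrix in $M_d(k\langle x_1,\dots,x_g\rangle)$ is called an atom if it is not a zero divisor, is not invertible, and is not a product of two non-invertible matrices in $M_d(k\langle x_1,\dots,x_g\rangle)$. A monic pencil of size $d$ is a matrix $L=I_d-\sum_{j=1}^g A_jx_j$ with $A_1,\dots,A_g\in M_d(k)$, and $L(X^{(n)})=I_{dn}-\sum_{j=1}^g A_j\otimes X^{(n)}_j$. For integers $\delta>1$ and $d>1$ set $$n_1(\delta)=\left\lceil \frac{\delta}{2}\right\rceil,\qquad n_2(d)=\begin{cases}1 & d=2,\\ \left\lceil (d-1)\sqrt{\frac{2(d-1)^2}{d-2}+\frac14}+\frac{d-1}{2}-2\right\rceil & d\ge 3.\end{cases}$$ (1)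 Let $f\in k\langle x_1,\dots,x_g\rangle$ have degree $\delta>1$ and $f(0)=1$. If $\det f(X^{(n)})$ is an irreducible polynomial for some $n\ge n_1(\delta)$, then $f$ is an atom. (2) Let $L$ be a monic pencil of size $d>1$. If $\det L(X^{(n)})$ is an irreducible polynomial for some $n\ge n_2(d)$, then $L$ is an atom in $M_d(k\langle x_1,\dots,x_g\rangle)$. -/

import Mathlib

open scoped Kronecker

noncomputable section

namespace FreeLocus

/-- The total degree of a noncommutative polynomial: the largest length of a word that occurs in it
with nonzero coefficient (`0` for the zero polynomial). -/
def ncDegree {k : Type*} [Field k] {g : ℕ} (f : FreeAlgebra k (Fin g)) : ℕ :=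
  (FreeAlgebra.equivMonoidAlgebraFreeMonoid f).coeff.support.sup FreeMonoid.length

/-- A noncommutative polynomial is constant if it is a scalar multiple of `1`. -/
def IsConstant {k : Type*} [Field k] {g : ℕ} (f : FreeAlgebra k (Fin g)) : Prop :=
  ∃ c : k, f = algebraMap k (FreeAlgebra k (Fin g)) c

/-- An atom of the free algebra: a nonconstant noncommutative polynomial that is not a product of
two nonconstant ones. -/
def IsPolyAtom {k : Type*} [Field k] {g : ℕ} (f : FreeAlgebra k (Fin g)) : Prop :=
  ¬ IsConstant f ∧
    ¬ ∃ f₁ f₂ : FreeAlgebra k (Fin g), ¬ IsConstant f₁ ∧ ¬ IsConstant f₂ ∧ f = f₁ * f₂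

/-- An atom of the ring of `d × d` matrices over the free algebra: a regular (not a left or right
zero divisor) non-invertible matrix that is not a product of two non-invertible matrices. -/
def IsMatrixAtom {k : Type*} [Field k] {g d : ℕ}
    (f : Matrix (Fin d) (Fin d) (FreeAlgebra k (Fin g))) : Prop :=
  IsRegular f ∧ ¬ IsUnit f ∧
    ¬ ∃ f₁ f₂ : Matrix (Fin d) (Fin d) (FreeAlgebra k (Fin g)),
      ¬ IsUnit f₁ ∧ ¬ IsUnit f₂ ∧ f = f₁ * f₂

/-- The `j`-th generic `n × n` matrix, whose entries are independent commuting variables. -/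
def genericMatrix (k : Type*) [Field k] (g n : ℕ) (j : Fin g) :
    Matrix (Fin n) (Fin n) (MvPolynomial (Fin g × Fin n × Fin n) k) :=
  Matrix.of fun r s => MvPolynomial.X (j, r, s)

/-- The evaluation of a noncommutative polynomial at the tuple of generic `n × n` matrices. -/
def polyEval {k : Type*} [Field k] {g : ℕ} (f : FreeAlgebra k (Fin g)) (n : ℕ) :
    Matrix (Fin n) (Fin n) (MvPolynomial (Fin g × Fin n × Fin n) k) :=
  FreeAlgebra.lift k (genericMatrix k g n) f

/-- The monic linear pencil `I - ∑ A_j x_j` as a matrix over the free algebra. -/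
def monicPencil {k : Type*} [Field k] {g d : ℕ} (A : Fin g → Matrix (Fin d) (Fin d) k) :
    Matrix (Fin d) (Fin d) (FreeAlgebra k (Fin g)) :=
  1 - ∑ j, (A j).map fun a => a • FreeAlgebra.ι k j

/-- The evaluation `I - ∑ A_j ⊗ X_j` of the monic pencil with coefficients `A` at the tuple of
generic `n × n` matrices. -/
def pencilEval {k : Type*} [Field k] {g d : ℕ} (A : Fin g → Matrix (Fin d) (Fin d) k) (n : ℕ) :
    Matrix (Fin d × Fin n) (Fin d × Fin n) (MvPolynomial (Fin g × Fin n × Fin n) k) :=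
  1 - ∑ j, (A j).map (fun a => MvPolynomial.C a) ⊗ₖ genericMatrix k g n j

/-- Evaluating the entries of the pencil over the free algebra gives the blocks of its Kronecker
product evaluation. -/
theorem pencilEval_apply {k : Type*} [Field k] {g d : ℕ} (A : Fin g → Matrix (Fin d) (Fin d) k)
    (n : ℕ) (p q : Fin d) (r s : Fin n) :
    pencilEval A n (p, r) (q, s) = polyEval (monicPencil A p q) n r s := by
  have h1 : FreeAlgebra.lift k (genericMatrix k g n) ((1 : Matrix (Fin d) (Fin d) _) p q) r s
      = (1 : Matrix (Fin d × Fin n) (Fin d × Fin n) (MvPolynomial (Fin g × Fin n × Fin n) k))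
        (p, r) (q, s) := by
    by_cases h : p = q
    · subst h
      by_cases h' : r = s <;> simp [Matrix.one_apply, h']
    · simp [Matrix.one_apply, h]
  simp [pencilEval, polyEval, monicPencil, Matrix.sub_apply, Matrix.sum_apply, h1,
    Matrix.kroneckerMap_apply, MvPolynomial.smul_eq_C_mul]

/-- The bound `⌈δ / 2⌉`. -/
def n₁ (δ : ℕ) : ℕ := ⌈(δ : ℝ) / 2⌉₊

/-- The bound for pencils of size `d ≥ 2`; for `d ≥ 3` the real number under the ceiling is
positive, so the natural-number ceiling is the usual one. -/
def n₂ (d : ℕ) : ℕ :=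
  if d = 2 then 1
  else ⌈((d : ℝ) - 1) * Real.sqrt (2 * ((d : ℝ) - 1) ^ 2 / ((d : ℝ) - 2) + 1 / 4)
    + ((d : ℝ) - 1) / 2 - 2⌉₊

end FreeLocus

end

/-! In both parts a bad factorization would factor the irreducible determinant, so one factor is a
unit in the polynomial ring, that is, a nonzero constant. It remains to show that a constant
determinant on matrices of a single moderate size already forces a trivial factor.

Polynomials. If `f = f₁ * f₂` with both factors nonconstant and `deg f ≤ 2n`, each factor has degree
below `2n`. Evaluate such a factor at a generic diagonal matrix plus `t` times a generic weighted
cyclic shift. The top `t`-coefficient of the determinant is, up to sign, a product of rotated copies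
of one polynomial that counts walks on an `n`-cycle, so a constant determinant makes this walk
polynomial constant. Every word of length below `2n` has its own monomial there, given by the walk
that alternates between staying and moving. Hence all nonconstant coefficients vanish
(`isConstant_of_isUnit_det`).

Pencils. If `L = F * G`, the constant vectors in the column space of `F` form a subspace invariant
under all `A j`. The coefficients cannot be jointly nilpotent on it, or `G` would be invertible, nor
on the quotient, or `F` would be. The determinant of `L` is the product of those of the restricted
and the induced pencil, whose sizes `e` satisfy `1 ≤ e ≤ d - 1`. A constant determinant on `n × n`
matrices with `n ≥ 2 (e - 1)` forces joint nilpotency (`exists_words_eq_zero_of_isUnit_det`): ranks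
of products of generic combinations stabilize after `e - 1` factors, so without joint nilpotency a
product of `n` of them is not nilpotent, and a cyclic shift turns this into a nonconstant
determinant. Finally `2 (d - 2) ≤ n₂ d`. -/

open scoped Kronecker

noncomputable section

namespace FreeLocus

/-! ### Ranks, nilpotency and specialization of determinants. -/

/-- The rank of a square matrix does not change under an extension of the ground field. -/
theorem rank_map_ringHom {K F m : Type*} [Field K] [Field F] [Fintype m] [DecidableEq m]
    (φ : K →+* F) (M : Matrix m m K) : (M.map φ).rank = M.rank := by
  classical
  obtain ⟨V, U, D, hM⟩ := Matrix.Pivot.exists_list_transvec_mul_mul_list_transvec_eq_diagonal M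
  set P := (V.map Matrix.TransvectionStruct.toMatrix).prod with hP
  set Q := (U.map Matrix.TransvectionStruct.toMatrix).prod with hQ
  have dP : P.det = 1 := Matrix.TransvectionStruct.det_toMatrix_prod V
  have dQ : Q.det = 1 := Matrix.TransvectionStruct.det_toMatrix_prod U
  have hM' : P.map φ * M.map φ * Q.map φ = Matrix.diagonal (φ ∘ D) := by
    rw [← Matrix.map_mul, ← Matrix.map_mul, hM, Matrix.diagonal_map (map_zero φ)]
    rfl
  have dP' : (P.map φ).det = 1 := by
    rw [← RingHom.mapMatrix_apply, ← RingHom.map_det, dP, map_one]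
  have dQ' : (Q.map φ).det = 1 := by
    rw [← RingHom.mapMatrix_apply, ← RingHom.map_det, dQ, map_one]
  rw [← Matrix.rank_mul_eq_right_of_isUnit_det (P.map φ) (M.map φ) (by simp [dP']),
    ← Matrix.rank_mul_eq_left_of_isUnit_det (Q.map φ) _ (by simp [dQ']), hM',
    ← Matrix.rank_mul_eq_right_of_isUnit_det P M (by simp [dP]),
    ← Matrix.rank_mul_eq_left_of_isUnit_det Q _ (by simp [dQ]), hM,
    Matrix.rank_diagonal, Matrix.rank_diagonal]
  simp

/-- If left multiplication by `M` preserves the rank of `N`, then `M` is injective on the column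
space of `N`. -/
theorem mulVec_eq_zero_of_rank_mul_eq {K m : Type*} [Field K] [Fintype m] [DecidableEq m]
    {M N : Matrix m m K} (h : (M * N).rank = N.rank) {x : m → K}
    (hx : M.mulVec (N.mulVec x) = 0) : N.mulVec x = 0 := by
  have hle : LinearMap.ker N.mulVecLin ≤ LinearMap.ker (M * N).mulVecLin := by
    intro y hy
    rw [LinearMap.mem_ker, Matrix.mulVecLin_apply] at hy ⊢
    rw [← Matrix.mulVec_mulVec, hy, Matrix.mulVec_zero]
  have h1 := LinearMap.finrank_range_add_finrank_ker N.mulVecLin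
  have h2 := LinearMap.finrank_range_add_finrank_ker (M * N).mulVecLin
  have h3 : Module.finrank K (LinearMap.range (M * N).mulVecLin)
      = Module.finrank K (LinearMap.range N.mulVecLin) := h
  have heq := Submodule.eq_of_le_of_finrank_eq hle (by omega)
  have hxm : x ∈ LinearMap.ker (M * N).mulVecLin := by
    rw [LinearMap.mem_ker, Matrix.mulVecLin_apply, ← Matrix.mulVec_mulVec, hx]
  rw [← heq, LinearMap.mem_ker, Matrix.mulVecLin_apply] at hxm
  exact hxm

/-- Converse of `mulVec_eq_zero_of_rank_mul_eq`: the two kernels agree, so rank-nullity gives equal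
ranks. -/
theorem rank_mul_eq_of_ker_le {K m : Type*} [Field K] [Fintype m] [DecidableEq m]
    {M N : Matrix m m K} (h : ∀ x, M.mulVec (N.mulVec x) = 0 → N.mulVec x = 0) :
    (M * N).rank = N.rank := by
  have heq : LinearMap.ker N.mulVecLin = LinearMap.ker (M * N).mulVecLin := by
    ext y
    simp only [LinearMap.mem_ker, Matrix.mulVecLin_apply, ← Matrix.mulVec_mulVec]
    exact ⟨fun hy => by rw [hy, Matrix.mulVec_zero], h y⟩
  have h1 := LinearMap.finrank_range_add_finrank_ker N.mulVecLin
  have h2 := LinearMap.finrank_range_add_finrank_ker (M * N).mulVecLin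
  rw [← heq] at h2
  have : Module.finrank K (LinearMap.range (M * N).mulVecLin)
      = Module.finrank K (LinearMap.range N.mulVecLin) := by omega
  exact this

/-- If two matrices of the same rank have products of that rank in both orders and are nonzero,
their product is not nilpotent. -/
theorem not_isNilpotent_mul_of_rank_eq {K m : Type*} [Field K] [Fintype m] [DecidableEq m]
    {M N : Matrix m m K} (h₁ : (M * N).rank = N.rank) (h₂ : (N * M).rank = M.rank)
    (h₀ : M * N ≠ 0) : ¬ IsNilpotent (M * N) := by
  -- The first rank equality cancels the leading `M` on the column space of `N`, the second then
  -- cancels `N` on the column space of `M`. So a vanishing power can be lowered down to `M * N`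
  -- itself.
  have step : ∀ r, (M * N) ^ (r + 2) = 0 → (M * N) ^ (r + 1) = 0 := by
    intro r hr
    refine Matrix.ext_of_mulVec_single fun i => ?_
    set x : m → K := Pi.single i 1
    rw [Matrix.zero_mulVec]
    have e1 : ((M * N) ^ (r + 1)).mulVec x = M.mulVec (N.mulVec (((M * N) ^ r).mulVec x)) := by
      rw [pow_succ', Matrix.mulVec_mulVec, Matrix.mulVec_mulVec]
    have e2 : M.mulVec (N.mulVec (M.mulVec (N.mulVec (((M * N) ^ r).mulVec x)))) = 0 := by
      rw [← e1, Matrix.mulVec_mulVec, Matrix.mulVec_mulVec, ← pow_succ', hr, Matrix.zero_mulVec]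
    rw [e1]
    exact mulVec_eq_zero_of_rank_mul_eq h₂ (mulVec_eq_zero_of_rank_mul_eq h₁ e2)
  have all : ∀ r, (M * N) ^ (r + 1) = 0 → M * N = 0 := by
    intro r
    induction r with
    | zero => intro h; simpa using h
    | succ r ih => exact fun h => ih (step r h)
  rintro ⟨r, hr⟩
  exact h₀ (all r (by rw [pow_succ, hr, zero_mul]))

/-- A square matrix over a field whose reversed characteristic polynomial is constant is
nilpotent. -/
theorem isNilpotent_of_charpolyRev_eq_C {K m : Type*} [Field K] [Fintype m] [DecidableEq m]
    {Z : Matrix m m K} {c : K} (h : Z.charpolyRev = Polynomial.C c) : IsNilpotent Z := by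
  have h1 : Z.charpolyRev = 1 := by
    have := Matrix.eval_charpolyRev (M := Z)
    rw [h, Polynomial.eval_C] at this
    rw [h, this, map_one]
  rw [← Matrix.reverse_charpoly] at h1
  have hlead := Z.charpoly_monic
  have h2 : Z.charpoly = Polynomial.X ^ Fintype.card m := by
    have hdeg := Z.charpoly_natDegree_eq_dim
    refine Polynomial.ext fun i => ?_
    rw [Polynomial.coeff_X_pow]
    rcases lt_trichotomy i (Fintype.card m) with hi | hi | hi
    · rw [if_neg hi.ne]
      have := congrArg (fun p => p.coeff (Fintype.card m - i)) h1
      simp only [Polynomial.coeff_reverse, hdeg, Polynomial.coeff_one] at this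
      rw [if_neg (by omega), Polynomial.revAt_le (by omega)] at this
      rwa [show Fintype.card m - (Fintype.card m - i) = i by omega] at this
    · rw [if_pos hi, hi, ← hdeg]
      exact hlead
    · rw [if_neg hi.ne', Polynomial.coeff_eq_zero_of_natDegree_lt (by omega)]
  refine ⟨Fintype.card m, ?_⟩
  have := Z.aeval_self_charpoly
  rwa [h2, map_pow, Polynomial.aeval_X] at this

/-- A specialization of the determinant of a pencil at generic matrices. -/
theorem aeval_det_pencilEval {k C : Type*} [Field k] [CommRing C] [Algebra k C] {g e n : ℕ}
    (A : Fin g → Matrix (Fin e) (Fin e) k) (X : Fin g → Matrix (Fin n) (Fin n) C) :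
    MvPolynomial.aeval (fun v : Fin g × Fin n × Fin n => X v.1 v.2.1 v.2.2) (pencilEval A n).det
      = (1 - ∑ j, (A j).map (algebraMap k C) ⊗ₖ X j).det := by
  rw [AlgHom.map_det]
  congr 1
  ext ⟨p, r⟩ ⟨q, s⟩
  simp [pencilEval, Matrix.sum_apply, Matrix.one_apply, genericMatrix, apply_ite,
    Matrix.sub_apply]

/-! ### Generic products of coefficients and joint nilpotency. -/

section Generic

variable {k : Type*} [Field k] {g e : ℕ} (B : Fin g → Matrix (Fin e) (Fin e) k)

/-- The `i`-th generic linear combination of the matrices `B`. -/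
def genericComb (i : ℕ) : Matrix (Fin e) (Fin e) (MvPolynomial (Fin g × ℕ) k) :=
  ∑ j, (MvPolynomial.X (j, i) : MvPolynomial (Fin g × ℕ) k) • (B j).map MvPolynomial.C

/-- The product of the generic linear combinations with indices in a list, over the field of
rational functions. -/
def genericProd (l : List ℕ) :
    Matrix (Fin e) (Fin e) (FractionRing (MvPolynomial (Fin g × ℕ) k)) :=
  ((l.map (genericComb B)).prod).map (algebraMap _ _)

theorem genericProd_append (l l' : List ℕ) :
    genericProd B (l ++ l') = genericProd B l * genericProd B l' := by
  simp only [genericProd, List.map_append, List.prod_append, Matrix.map_mul]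

theorem genericProd_nil : genericProd B [] = 1 := by
  simp [genericProd, Matrix.map_one]

theorem genericProd_cons (i : ℕ) (l : List ℕ) :
    genericProd B (i :: l) = genericProd B [i] * genericProd B l := by
  rw [← genericProd_append, List.singleton_append]

/-- Renaming variables along an injection is an injective ring endomorphism, so it extends to the
fraction field, where field homomorphisms preserve rank. Hence for lists of distinct indices only
the length matters. -/
theorem rank_genericProd_map {φ : ℕ → ℕ} (hφ : Function.Injective φ) (l : List ℕ) :
    (genericProd B (l.map φ)).rank = (genericProd B l).rank := by
  have hinj : Function.Injective (Prod.map (id : Fin g → Fin g) φ) :=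
    Function.injective_id.prodMap hφ
  set ρ : MvPolynomial (Fin g × ℕ) k →+* MvPolynomial (Fin g × ℕ) k :=
    (MvPolynomial.rename (Prod.map (id : Fin g → Fin g) φ)).toRingHom with hρ
  have hρinj : Function.Injective ρ := MvPolynomial.rename_injective _ hinj
  let ψ : FractionRing (MvPolynomial (Fin g × ℕ) k) →+* FractionRing (MvPolynomial (Fin g × ℕ) k) :=
    IsFractionRing.map hρinj
  have hcomb : ∀ i, (genericComb B i).map ρ = genericComb B (φ i) := by
    intro i
    ext p q
    simp [genericComb, Matrix.sum_apply, hρ]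
  have hprod : ((l.map (genericComb B)).prod).map ρ = ((l.map φ).map (genericComb B)).prod := by
    rw [← RingHom.mapMatrix_apply, map_list_prod, List.map_map, List.map_map]
    congr 2
    funext i
    exact hcomb i
  have : genericProd B (l.map φ) = (genericProd B l).map ψ := by
    rw [genericProd, ← hprod, genericProd, Matrix.map_map, Matrix.map_map]
    congr 1
    funext x
    exact (IsLocalization.map_eq _ x).symm
  rw [this, rank_map_ringHom]

/-- The rank of a product of `m` independent generic linear combinations. -/
def genericRank (m : ℕ) : ℕ := (genericProd B (List.range m)).rank

theorem rank_genericProd_range' (s m : ℕ) :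
    (genericProd B (List.range' s m)).rank = genericRank B m := by
  rw [genericRank, List.range_eq_range',
    ← rank_genericProd_map B (add_right_injective s) (List.range' 0 m), List.map_add_range', add_zero]

theorem genericRank_zero : genericRank B 0 = e := by
  rw [genericRank, List.range_zero, genericProd_nil, Matrix.rank_one, Fintype.card_fin]

theorem range_succ_eq_cons (m : ℕ) : List.range (m + 1) = 0 :: List.range' 1 m := by
  rw [List.range_eq_range', List.range'_succ]

theorem genericRank_succ_le (m : ℕ) : genericRank B (m + 1) ≤ genericRank B m := by
  rw [genericRank, range_succ_eq_cons, genericProd_cons, ← rank_genericProd_range' B 1 m]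
  exact Matrix.rank_mul_le_right _ _

/-- Equality of ranks means that the leading factor is injective on the column space of the other
`m`. Appending one more factor on the right only shrinks that column space, so injectivity persists.
-/
theorem genericRank_stable {m : ℕ} (h : genericRank B (m + 1) = genericRank B m) :
    genericRank B (m + 2) = genericRank B (m + 1) := by
  have h1 : (genericProd B [0] * genericProd B (List.range' 1 m)).rank
      = (genericProd B (List.range' 1 m)).rank := by
    rw [← genericProd_cons, ← range_succ_eq_cons, rank_genericProd_range']
    exact h
  have h2 : List.range (m + 2) = 0 :: List.range' 1 (m + 1) := range_succ_eq_cons (m + 1)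
  rw [genericRank, h2, genericProd_cons, ← rank_genericProd_range' B 1 (m + 1)]
  refine rank_mul_eq_of_ker_le fun x hx => ?_
  rw [List.range'_concat, genericProd_append, ← Matrix.mulVec_mulVec] at hx ⊢
  exact mulVec_eq_zero_of_rank_mul_eq h1 hx

theorem genericRank_eq_of_le {m : ℕ} (h : genericRank B (m + 1) = genericRank B m) {m' : ℕ}
    (hm : m ≤ m') : genericRank B m' = genericRank B m := by
  have key : ∀ r, genericRank B (m + r + 1) = genericRank B (m + r) := by
    intro r
    induction r with
    | zero => exact h
    | succ r ih => exact genericRank_stable B ih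
  obtain ⟨r, rfl⟩ := Nat.exists_eq_add_of_le hm
  clear hm
  induction r with
  | zero => rfl
  | succ r ih => rw [← ih]; exact key r

/-- The ranks start at `e` and are constant after the first repetition. Without a repetition by
index `e` they would drop `e` times and reach zero. -/
theorem genericRank_const (hpos : ∀ m, genericRank B m ≠ 0) {m : ℕ} (hm : e ≤ m + 1) :
    genericRank B m = genericRank B (e - 1) := by
  refine genericRank_eq_of_le B ?_ (by omega)
  by_contra hne
  have hlt : ∀ i, i ≤ e - 1 → genericRank B (i + 1) < genericRank B i := by
    intro i hi
    refine lt_of_le_of_ne (genericRank_succ_le B i) fun h => hne ?_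
    rw [genericRank_eq_of_le B h (by omega), genericRank_eq_of_le B h hi]
  have hsum : ∀ i, i ≤ e - 1 + 1 → genericRank B i + i ≤ e := by
    intro i
    induction i with
    | zero => intro _; simp [genericRank_zero]
    | succ i ih =>
      intro hi
      have := ih (by omega)
      have := hlt i (by omega)
      omega
  have := hsum (e - 1 + 1) le_rfl
  have := hpos (e - 1 + 1)
  omega

theorem not_isNilpotent_genericProd (hpos : ∀ m, genericRank B m ≠ 0) {n : ℕ}
    (hn : 2 * (e - 1) ≤ n) : ¬ IsNilpotent (genericProd B (List.range n)) := by
  -- Both halves have length at least `e - 1`, so each half and the whole product have the stable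
  -- rank.
  set a := n / 2
  obtain ⟨b, hb⟩ : ∃ b, n = a + b := ⟨n - a, by omega⟩
  have hsplit : genericProd B (List.range n)
      = genericProd B (List.range' 0 a) * genericProd B (List.range' a b) := by
    rw [← genericProd_append, hb, List.range_eq_range']
    congr 1
    have := List.range'_append (s := 0) (m := a) (n := b) (step := 1)
    simpa using this.symm
  have hra : genericRank B a = genericRank B (e - 1) := genericRank_const B hpos (by omega)
  have hrb : genericRank B b = genericRank B (e - 1) := genericRank_const B hpos (by omega)
  have hrn : genericRank B n = genericRank B (e - 1) := genericRank_const B hpos (by omega)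
  have hswap : (genericProd B (List.range' a b) * genericProd B (List.range' 0 a)).rank
      = genericRank B n := by
    -- Shifting the first block past the second turns the swapped list into `n` consecutive indices
    -- starting at `a`. The last branch only keeps `φ` injective.
    let φ : ℕ → ℕ := fun i => if i < a then i + n else if i < n then i else i + a
    have hφ : Function.Injective φ := by
      intro i j hij
      simp only [φ] at hij
      split_ifs at hij <;> omega
    rw [← genericProd_append, ← rank_genericProd_map B hφ, ← rank_genericProd_range' B a n]
    congr 2
    have e1 : (List.range' a b).map φ = List.range' a b := by
      conv_rhs => rw [← List.map_id (List.range' a b)]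
      refine List.map_congr_left fun i hi => ?_
      rw [List.mem_range'_1] at hi
      simp only [φ, id]
      rw [if_neg (by omega), if_pos (by omega)]
    have e2 : (List.range' 0 a).map φ = List.range' n a := by
      have : List.range' n a = (List.range' 0 a).map (n + ·) := by
        rw [List.map_add_range', add_zero]
      rw [this]
      refine List.map_congr_left fun i hi => ?_
      rw [List.mem_range'_1] at hi
      simp only [φ]
      rw [if_pos (by omega), add_comm]
    rw [List.map_append, e1, e2, hb]
    have := List.range'_append (s := a) (m := b) (n := a) (step := 1)
    rw [add_comm a b]
    convert this using 2
    simp [add_comm]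
  have hne : genericProd B (List.range' 0 a) * genericProd B (List.range' a b) ≠ 0 := by
    intro h0
    apply hpos n
    rw [genericRank, hsplit, h0, Matrix.rank_zero]
  rw [hsplit]
  refine not_isNilpotent_mul_of_rank_eq ?_ ?_ hne
  · rw [← hsplit, rank_genericProd_range', hrb, ← hrn]; rfl
  · rw [hswap, rank_genericProd_range', hra, hrn]

/-- A nonzero word product of length `m` is a specialization of the generic product: in position
`i`, the variable of the `i`-th letter becomes `1` and all others `0`. -/
theorem genericRank_ne_zero (h : ∀ N : ℕ, ∃ w : List (Fin g), w.length = N ∧ (w.map B).prod ≠ 0)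
    (m : ℕ) : genericRank B m ≠ 0 := by
  intro h0
  obtain ⟨w, hw, hne⟩ := h m
  have hz : genericProd B (List.range m) = 0 := by
    rw [genericRank, Matrix.rank] at h0
    have := Submodule.finrank_eq_zero.mp h0
    rw [LinearMap.range_eq_bot] at this
    refine Matrix.ext_of_mulVec_single fun i => ?_
    rw [← Matrix.mulVecLin_apply, this, LinearMap.zero_apply, Matrix.zero_mulVec]
  have hz' : ((List.range m).map (genericComb B)).prod = 0 := by
    refine Matrix.map_injective (IsFractionRing.injective (MvPolynomial (Fin g × ℕ) k)
      (FractionRing (MvPolynomial (Fin g × ℕ) k))) ?_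
    exact hz.trans (Matrix.map_zero _ (map_zero _)).symm
  apply hne
  let ev : MvPolynomial (Fin g × ℕ) k →+* k :=
    MvPolynomial.eval fun v => if w[v.2]? = some v.1 then 1 else 0
  have := congrArg (fun M => ev.mapMatrix M) hz'
  simp only [map_list_prod, List.map_map, map_zero] at this
  rw [← this]
  congr 1
  apply List.ext_getElem
  · simp [hw]
  · intro i h1 h2
    rw [List.length_map] at h1
    simp only [List.getElem_map, List.getElem_range, Function.comp_apply]
    ext p q
    simp [genericComb, Matrix.sum_apply, ev, List.getElem?_eq_getElem h1]

theorem ofNat_succ_eq (n m : ℕ) : Fin.ofNat (n + 1) (m + 1) = Fin.ofNat (n + 1) m + 1 := by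
  apply Fin.ext
  simp [Fin.val_add]

theorem genericProd_mod_mul (n M : ℕ) :
    genericProd B ((List.range (n * M)).map (· % n)) = genericProd B (List.range n) ^ M := by
  induction M with
  | zero => simp [genericProd_nil]
  | succ M ih =>
    rw [Nat.mul_succ, List.range_add, List.map_append, genericProd_append, ih, pow_succ,
      List.map_map]
    congr 2
    conv_rhs => rw [← List.map_id (List.range n)]
    refine List.map_congr_left fun i hi => ?_
    rw [List.mem_range] at hi
    simp [Nat.mod_eq_of_lt hi]

/-- If the determinant of a pencil of size `e` is constant on `n × n` matrices for some
`n ≥ 2 (e - 1)`, then its coefficients are jointly nilpotent. -/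
theorem exists_words_eq_zero_of_isUnit_det {n : ℕ} (hn : 1 ≤ n) (hn' : 2 * (e - 1) ≤ n)
    (h : IsUnit (pencilEval B n).det) :
    ∃ N : ℕ, ∀ w : List (Fin g), w.length = N → (w.map B).prod = 0 := by
  by_contra! hcon
  refine not_isNilpotent_genericProd B (genericRank_ne_zero B hcon) hn' ?_
  obtain ⟨n, rfl⟩ : ∃ m, n = m + 1 := ⟨n - 1, by omega⟩
  obtain ⟨c, -, hc⟩ := MvPolynomial.isUnit_iff_eq_C_of_isReduced.mp h
  let K := FractionRing (MvPolynomial (Fin g × ℕ) k)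
  let y : Fin g → ℕ → K := fun j i => algebraMap (MvPolynomial (Fin g × ℕ) k) K (MvPolynomial.X (j, i))
  -- Addition in `Fin (n + 1)` wraps around, so these are weighted cyclic shifts. The block of `Z`
  -- from `i` to `i + 1` is the `i`-th generic combination.
  let X : Fin g → Matrix (Fin (n + 1)) (Fin (n + 1)) K := fun j =>
    Matrix.of fun i i' => if i + 1 = i' then y j i else 0
  let Z : Matrix (Fin e × Fin (n + 1)) (Fin e × Fin (n + 1)) K :=
    ∑ j, (B j).map (algebraMap k K) ⊗ₖ X j
  have hZ : ∀ r i q i', Z (r, i) (q, i') = if i + 1 = i' then genericProd B [(i : ℕ)] r q else 0 := by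
    intro r i q i'
    simp only [Z, X, Matrix.sum_apply, Matrix.kroneckerMap_apply, Matrix.map_apply, Matrix.of_apply]
    split_ifs with hi
    · simp only [genericProd, List.map_cons, List.map_nil, List.prod_singleton, genericComb,
        Matrix.map_apply, Matrix.sum_apply, Matrix.smul_apply, map_sum, smul_eq_mul, map_mul]
      refine Finset.sum_congr rfl fun j _ => ?_
      rw [mul_comm]
      rfl
    · simp
  have hnil : IsNilpotent Z := by
    refine isNilpotent_of_charpolyRev_eq_C (c := algebraMap k K c) ?_
    -- Scaling the shifts by the univariate variable turns the constant determinant into the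
    -- reversed characteristic polynomial of `Z`.
    have h1 := aeval_det_pencilEval (C := Polynomial K) B
      (fun j => (Polynomial.X : Polynomial K) • (X j).map Polynomial.C)
    rw [hc, MvPolynomial.aeval_C] at h1
    rw [Matrix.charpolyRev]
    refine Eq.trans ?_ h1.symm
    congr 2
    ext1 ⟨r, i⟩ ⟨q, i'⟩
    simp only [Z, Matrix.smul_apply, Matrix.map_apply, Matrix.sum_apply, Matrix.kroneckerMap_apply,
      map_sum, map_mul, smul_eq_mul, Finset.mul_sum]
    refine Finset.sum_congr rfl fun j _ => ?_
    rw [IsScalarTower.algebraMap_apply k K (Polynomial K), Polynomial.algebraMap_eq]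
    ring
  have hpow : ∀ (m : ℕ) (p q : Fin e) (i' : Fin (n + 1)), (Z ^ m) (p, 0) (q, i') =
      if Fin.ofNat (n + 1) m = i' then
        genericProd B ((List.range m).map (· % (n + 1))) p q else 0 := by
    intro m
    induction m with
    | zero =>
      intro p q i'
      by_cases h1 : p = q <;> by_cases h2 : 0 = i' <;>
        simp [genericProd_nil, h1, h2]
    | succ m ih =>
      intro p q i'
      rw [pow_succ, Matrix.mul_apply, Fintype.sum_prod_type]
      simp only [ih, hZ, ite_mul, zero_mul, Finset.sum_ite_eq, Finset.mem_univ, if_true]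
      rw [List.range_succ, List.map_append, genericProd_append, ofNat_succ_eq]
      split_ifs with hi
      · rw [Matrix.mul_apply]
        simp
      · simp
  obtain ⟨M, hM⟩ := hnil
  refine ⟨M, ?_⟩
  rw [← genericProd_mod_mul]
  ext p q
  have := hpow ((n + 1) * M) p q (Fin.ofNat (n + 1) ((n + 1) * M))
  -- After `M` full turns the block in row `0` is the `M`-th power of the generic product, so
  -- nilpotency of `Z` passes to that product.
  have hz : Z ^ ((n + 1) * M) = 0 := by
    rw [mul_comm, pow_mul, hM, zero_pow (by omega)]
  rw [if_pos rfl, hz] at this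
  exact this.symm

end Generic

/-! ### Words, coefficients and degree in the free algebra. -/

section Words

variable {k : Type*} [Field k] {g : ℕ}

/-- The coefficient of a word in a noncommutative polynomial. -/
def wordCoeff (f : FreeAlgebra k (Fin g)) (w : List (Fin g)) : k :=
  (FreeAlgebra.equivMonoidAlgebraFreeMonoid f).coeff (FreeMonoid.ofList w)

/-- The linear extension to the free algebra of a function on words. -/
def wordSum {V : Type*} [AddCommMonoid V] [Module k V] (u : List (Fin g) → V)
    (f : FreeAlgebra k (Fin g)) : V :=
  (FreeAlgebra.equivMonoidAlgebraFreeMonoid f).coeff.sum fun w a => a • u w.toList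

theorem map_wordSum {V V' : Type*} [AddCommMonoid V] [Module k V] [AddCommMonoid V'] [Module k V']
    (φ : V →ₗ[k] V') (u : List (Fin g) → V) (f : FreeAlgebra k (Fin g)) :
    φ (wordSum u f) = wordSum (fun w => φ (u w)) f := by
  simp [wordSum, Finsupp.sum]

theorem lift_eq_wordSum {A : Type*} [Ring A] [Algebra k A] (F : Fin g → A)
    (f : FreeAlgebra k (Fin g)) :
    FreeAlgebra.lift k F f = wordSum (fun w => (w.map F).prod) f := by
  have h : FreeAlgebra.lift k F = (MonoidAlgebra.lift k A (FreeMonoid (Fin g))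
      (FreeMonoid.lift F)).comp FreeAlgebra.equivMonoidAlgebraFreeMonoid.toAlgHom := by
    ext i
    simp [FreeAlgebra.equivMonoidAlgebraFreeMonoid]
  rw [h]
  simp [MonoidAlgebra.lift_apply, wordSum, FreeMonoid.lift_apply]

theorem wordSum_ite [DecidableEq (List (Fin g))] (v : List (Fin g)) (f : FreeAlgebra k (Fin g)) :
    wordSum (fun w => if w = v then (1 : k) else 0) f = wordCoeff f v := by
  rw [wordSum, wordCoeff, Finsupp.sum, Finset.sum_eq_single (FreeMonoid.ofList v)]
  · simp
  · intro w _ hw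
    rw [if_neg, smul_zero]
    rintro rfl
    exact hw rfl
  · intro h
    rw [Finsupp.notMem_support_iff.mp h, zero_smul]

theorem isConstant_of_wordCoeff_eq_zero {f : FreeAlgebra k (Fin g)}
    (h : ∀ w, w ≠ [] → wordCoeff f w = 0) : IsConstant f := by
  refine ⟨wordCoeff f [], FreeAlgebra.equivMonoidAlgebraFreeMonoid.injective ?_⟩
  rw [AlgEquiv.commutes]
  ext w
  by_cases hw : w = 1
  · subst hw
    simp [wordCoeff, MonoidAlgebra.coe_algebraMap]
  · have : (FreeAlgebra.equivMonoidAlgebraFreeMonoid f).coeff w = 0 := h w.toList hw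
    rw [this]
    simp [MonoidAlgebra.coe_algebraMap, Ne.symm hw]

theorem ncDegree_eq_zero_of_isConstant {f : FreeAlgebra k (Fin g)} (h : IsConstant f) :
    ncDegree f = 0 := by
  obtain ⟨c, rfl⟩ := h
  rw [ncDegree, AlgEquiv.commutes, ← Nat.bot_eq_zero, Finset.sup_eq_bot_iff]
  intro w hw
  have : w = 1 := by
    by_contra hne
    simp [MonoidAlgebra.coe_algebraMap, Ne.symm hne] at hw
  rw [this]
  rfl

theorem wordCoeff_eq_zero_of_ncDegree_lt {f : FreeAlgebra k (Fin g)} {w : List (Fin g)}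
    (h : ncDegree f < w.length) : wordCoeff f w = 0 := by
  by_contra hne
  have : FreeMonoid.ofList w ∈ (FreeAlgebra.equivMonoidAlgebraFreeMonoid f).coeff.support :=
    Finsupp.mem_support_iff.mpr hne
  exact absurd (Finset.le_sup (f := FreeMonoid.length) this) (not_le.mpr h)

theorem isConstant_of_ncDegree_eq_zero {f : FreeAlgebra k (Fin g)} (h : ncDegree f = 0) :
    IsConstant f :=
  isConstant_of_wordCoeff_eq_zero fun w hw => wordCoeff_eq_zero_of_ncDegree_lt <| by
    rw [h]; exact List.length_pos_of_ne_nil hw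

theorem exists_length_eq_ncDegree {f : FreeAlgebra k (Fin g)} (h : f ≠ 0) :
    ∃ w ∈ (FreeAlgebra.equivMonoidAlgebraFreeMonoid f).coeff.support,
      FreeMonoid.length w = ncDegree f := by
  have hne : (FreeAlgebra.equivMonoidAlgebraFreeMonoid f).coeff.support.Nonempty := by
    rw [Finsupp.support_nonempty_iff]
    simpa using h
  obtain ⟨w, hw, hsup⟩ := Finset.exists_mem_eq_sup _ hne FreeMonoid.length
  exact ⟨w, hw, hsup.symm⟩

/-- Words of maximal length do not cancel: among the words of the two supports, a concatenation of
two longest ones splits uniquely, since lengths fix the cut. -/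
theorem ncDegree_add_le_ncDegree_mul {f₁ f₂ : FreeAlgebra k (Fin g)} (h₁ : f₁ ≠ 0) (h₂ : f₂ ≠ 0) :
    ncDegree f₁ + ncDegree f₂ ≤ ncDegree (f₁ * f₂) := by
  obtain ⟨v₁, hv₁, hl₁⟩ := exists_length_eq_ncDegree h₁
  obtain ⟨v₂, hv₂, hl₂⟩ := exists_length_eq_ncDegree h₂
  have huniq : UniqueMul (FreeAlgebra.equivMonoidAlgebraFreeMonoid f₁).coeff.support
      (FreeAlgebra.equivMonoidAlgebraFreeMonoid f₂).coeff.support v₁ v₂ := by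
    intro a b ha hb hab
    have la : FreeMonoid.length a ≤ ncDegree f₁ := Finset.le_sup (f := FreeMonoid.length) ha
    have lb : FreeMonoid.length b ≤ ncDegree f₂ := Finset.le_sup (f := FreeMonoid.length) hb
    have hlen : FreeMonoid.length a + FreeMonoid.length b
        = FreeMonoid.length v₁ + FreeMonoid.length v₂ := by
      rw [← FreeMonoid.length_mul, hab, FreeMonoid.length_mul]
    have : a.toList ++ b.toList = v₁.toList ++ v₂.toList := hab
    have := List.append_inj this (show FreeMonoid.length a = FreeMonoid.length v₁ by omega)
    exact this
  have hmem : v₁ * v₂ ∈ (FreeAlgebra.equivMonoidAlgebraFreeMonoid (f₁ * f₂)).coeff.support := by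
    rw [Finsupp.mem_support_iff, map_mul FreeAlgebra.equivMonoidAlgebraFreeMonoid,
      MonoidAlgebra.coeff_mul_mul_of_uniqueMul huniq]
    exact mul_ne_zero (Finsupp.mem_support_iff.mp hv₁) (Finsupp.mem_support_iff.mp hv₂)
  have := Finset.le_sup (f := FreeMonoid.length) hmem
  rw [FreeMonoid.length_mul, hl₁, hl₂] at this
  exact this

end Words

/-! ### Walks on a path and the monomial that singles out a word. -/

section Stair

variable (k : Type*) [Field k] {g : ℕ}

/-- The generating polynomial of the walks that read the word, start at the vertex `s` and at each
letter either stay or move to the next vertex, as long as they do not pass the vertex `n`. -/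
def walkPoly (n : ℕ) : ℕ → List (Fin g) → MvPolynomial (Fin g × Bool × ℕ) k
  | _, [] => 1
  | s, j :: w => MvPolynomial.X (j, false, s) * walkPoly n s w +
      if s < n then MvPolynomial.X (j, true, s) * walkPoly n (s + 1) w else 0

/-- The exponent of the walk that alternates between staying and moving; the boolean tells whether
it begins with a move. -/
def stair : Bool → ℕ → List (Fin g) → (Fin g × Bool × ℕ →₀ ℕ)
  | _, _, [] => 0
  | false, s, i :: v => Finsupp.single (i, false, s) 1 + stair true s v
  | true, s, i :: v => Finsupp.single (i, true, s) 1 + stair false (s + 1) v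

theorem stair_apply_of_lt (b : Bool) (s : ℕ) (v : List (Fin g)) (j : Fin g) (b' : Bool) {s' : ℕ}
    (h : s' < s) : stair b s v (j, b', s') = 0 := by
  induction v generalizing b s with
  | nil => simp [stair]
  | cons i v ih =>
    cases b
    · simp [stair, ih true s h, h.ne']
    · simp [stair, ih false (s + 1) (by omega), h.ne']

theorem stair_true_apply_false (s : ℕ) (v : List (Fin g)) (j : Fin g) :
    stair true s v (j, false, s) = 0 := by
  cases v with
  | nil => simp [stair]
  | cons i v => simp [stair, stair_apply_of_lt false (s + 1) v j false (Nat.lt_succ_self s)]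

theorem stair_ne_zero (b : Bool) (s : ℕ) {v : List (Fin g)} (h : v ≠ []) : stair b s v ≠ 0 := by
  cases v with
  | nil => exact absurd rfl h
  | cons i v =>
    cases b
    · intro h0
      have := DFunLike.congr_fun h0 (i, false, s)
      simp [stair] at this
    · intro h0
      have := DFunLike.congr_fun h0 (i, true, s)
      simp [stair] at this

/-- A walk never returns to an earlier vertex, so its monomial contains no variable of a vertex
before the start. -/
theorem coeff_walkPoly_of_lt (n s : ℕ) (w : List (Fin g)) {μ : Fin g × Bool × ℕ →₀ ℕ} {j : Fin g}
    {b : Bool} {s' : ℕ} (h : s' < s) (hμ : μ (j, b, s') ≠ 0) :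
    MvPolynomial.coeff μ (walkPoly k n s w) = 0 := by
  induction w generalizing s μ with
  | nil =>
    rw [walkPoly, MvPolynomial.coeff_one, if_neg]
    rintro rfl
    exact hμ rfl
  | cons i w ih =>
    have hsub : ∀ b', (μ - Finsupp.single (i, b', s) 1 : Fin g × Bool × ℕ →₀ ℕ) (j, b, s') ≠ 0 := by
      intro b'
      simpa [Finsupp.single_apply, h.ne'] using hμ
    rw [walkPoly, MvPolynomial.coeff_add, MvPolynomial.coeff_X_mul', ih s h (hsub false), ite_self,
      zero_add]
    split_ifs
    · rw [MvPolynomial.coeff_X_mul', ih (s + 1) (by omega) (hsub true), ite_self]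
    · simp

/-- The staircase uses each loop and each edge at most once, so its monomial dictates the walk and
the letter read at each step. On the vertices `0, …, n` it offers `n + 1` loops and `n` edges, hence
room for words of length `2n + 1` from vertex `0`. -/
theorem coeff_stair_walkPoly (n : ℕ) (v w : List (Fin g)) (b : Bool) (s : ℕ) (hs : s ≤ n)
    (hv : v.length + 2 * s ≤ 2 * n + (if b then 0 else 1)) :
    MvPolynomial.coeff (stair b s v) (walkPoly k n s w) = if w = v then 1 else 0 := by
  induction v generalizing w b s with
  | nil =>
    cases w with
    | nil => simp [stair, walkPoly]
    | cons j w =>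
      rw [walkPoly, stair, MvPolynomial.coeff_add, MvPolynomial.coeff_X_mul']
      split_ifs <;> simp_all [MvPolynomial.coeff_X_mul']
  | cons i v ih =>
    cases w with
    | nil =>
      rw [walkPoly, MvPolynomial.coeff_one, if_neg (stair_ne_zero b s (List.cons_ne_nil i v)).symm]
      simp
    | cons j w =>
      rw [List.length_cons] at hv
      cases b
      -- Moving on at once would lose the loop at `s`, which the monomial requires.
      · have h2 : MvPolynomial.coeff (stair false s (i :: v))
            (if s < n then MvPolynomial.X (j, true, s) * walkPoly k n (s + 1) w else 0) = 0 := by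
          split_ifs
          · rw [MvPolynomial.coeff_X_mul', coeff_walkPoly_of_lt k n (s + 1) w (j := i) (b := false)
              (Nat.lt_succ_self s), ite_self]
            simp [stair]
          · simp
        rw [walkPoly, MvPolynomial.coeff_add, h2, add_zero, MvPolynomial.coeff_X_mul']
        by_cases hij : j = i
        · subst hij
          rw [if_pos (by simp [stair]), stair, add_tsub_cancel_left, ih w true s hs (by simp at hv ⊢; omega)]
          simp
        · rw [if_neg, if_neg (by simp [hij])]
          simp [stair, stair_true_apply_false, Ne.symm hij]
      · simp at hv
        have hsn : s < n := by omega
        rw [walkPoly, MvPolynomial.coeff_add, MvPolynomial.coeff_X_mul', if_neg (by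
          rw [Finsupp.mem_support_iff, not_not]; exact stair_true_apply_false s _ j), zero_add,
          if_pos hsn, MvPolynomial.coeff_X_mul']
        by_cases hij : j = i
        · subst hij
          rw [if_pos (by simp [stair]), stair, add_tsub_cancel_left,
            ih w false (s + 1) (by omega) (by simp; omega)]
          simp
        · rw [if_neg, if_neg (by simp [hij])]
          simp [stair, stair_apply_of_lt false (s + 1) v j true (Nat.lt_succ_self s), Ne.symm hij]

end Stair

/-! ### Walks on a cycle, and the polynomial half of the theorem. -/

section Cyclic

variable (k : Type*) [Field k] {g : ℕ} (n : ℕ)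

/-- The generating polynomial of the walks on a cycle of length `n + 1` that read the word, start at
the vertex `i` and at each letter either stay or move on; the univariate variable counts the
moves. -/
def cyclePoly : Fin (n + 1) → List (Fin g) →
    Polynomial (MvPolynomial (Fin g × Bool × Fin (n + 1)) k)
  | _, [] => 1
  | i, j :: w => Polynomial.C (MvPolynomial.X (j, false, i)) * cyclePoly i w +
      Polynomial.C (MvPolynomial.X (j, true, i)) * (Polynomial.X * cyclePoly (i + 1) w)

/-- The sum of a generic diagonal matrix and a generic weighted cyclic shift. -/
def cycleMatrix (j : Fin g) : Matrix (Fin (n + 1)) (Fin (n + 1))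
    (Polynomial (MvPolynomial (Fin g × Bool × Fin (n + 1)) k)) :=
  Matrix.of fun i i' => (if i = i' then Polynomial.C (MvPolynomial.X (j, false, i)) else 0) +
    if i + 1 = i' then Polynomial.C (MvPolynomial.X (j, true, i)) * Polynomial.X else 0

/-- A walk with `m` moves from `i` ends at `i + m`. So each power of the variable occurs in exactly
one column of a given row, and the single polynomial `cyclePoly` records the whole row. -/
theorem coeff_prod_cycleMatrix (w : List (Fin g)) (i i' : Fin (n + 1)) (m : ℕ) :
    ((w.map (cycleMatrix k n)).prod i i').coeff m =
      if i + Fin.ofNat (n + 1) m = i' then (cyclePoly k n i w).coeff m else 0 := by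
  induction w generalizing i m with
  | nil =>
    simp only [List.map_nil, List.prod_nil, Matrix.one_apply, cyclePoly, Polynomial.coeff_one]
    by_cases hm : m = 0
    · subst hm
      by_cases hi : i = i' <;> simp [hi]
    · by_cases hi : i = i' <;> simp [hi, hm, Polynomial.coeff_one]
  | cons j w ih =>
    have hsum : ((List.map (cycleMatrix k n) (j :: w)).prod) i i' =
        Polynomial.C (MvPolynomial.X (j, false, i)) * (w.map (cycleMatrix k n)).prod i i' +
        Polynomial.C (MvPolynomial.X (j, true, i)) *
          (Polynomial.X * (w.map (cycleMatrix k n)).prod (i + 1) i') := by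
      rw [List.map_cons, List.prod_cons, Matrix.mul_apply]
      simp only [cycleMatrix, Matrix.of_apply, add_mul, ite_mul, zero_mul, Finset.sum_add_distrib,
        Finset.sum_ite_eq, Finset.mem_univ, if_true, mul_assoc]
    rw [hsum, cyclePoly]
    cases m with
    | zero => simp [ih]
    | succ m =>
      have hi : i + 1 + Fin.ofNat (n + 1) m = i + Fin.ofNat (n + 1) (m + 1) := by
        rw [ofNat_succ_eq, add_right_comm, add_assoc]
      rw [Polynomial.coeff_add, Polynomial.coeff_C_mul, Polynomial.coeff_C_mul,
        Polynomial.coeff_X_mul, ih, ih, hi, Polynomial.coeff_add, Polynomial.coeff_C_mul,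
        Polynomial.coeff_C_mul, Polynomial.coeff_X_mul]
      split_ifs <;> simp

variable {k}

theorem coeff_lift_cycleMatrix (f : FreeAlgebra k (Fin g)) (i i' : Fin (n + 1)) (m : ℕ) :
    (FreeAlgebra.lift k (cycleMatrix k n) f i i').coeff m =
      if i + Fin.ofNat (n + 1) m = i' then (wordSum (cyclePoly k n i) f).coeff m else 0 := by
  rw [lift_eq_wordSum]
  simp only [wordSum, Finsupp.sum, Matrix.sum_apply, Matrix.smul_apply, Polynomial.finsetSum_coeff,
    Polynomial.coeff_smul, coeff_prod_cycleMatrix]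
  split_ifs <;> simp

theorem aeval_det_polyEval {C : Type*} [CommRing C] [Algebra k C] {n : ℕ}
    (X : Fin g → Matrix (Fin n) (Fin n) C) (f : FreeAlgebra k (Fin g)) :
    MvPolynomial.aeval (fun v : Fin g × Fin n × Fin n => X v.1 v.2.1 v.2.2) (polyEval f n).det
      = (FreeAlgebra.lift k X f).det := by
  rw [AlgHom.map_det]
  congr 1
  have : ((MvPolynomial.aeval (R := k) (fun v : Fin g × Fin n × Fin n =>
      X v.1 v.2.1 v.2.2)).mapMatrix).comp (FreeAlgebra.lift k (genericMatrix k g n))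
      = FreeAlgebra.lift k X := by
    ext j r s
    simp [genericMatrix]
  exact DFunLike.congr_fun this f

/-- The rotation of the cycle. -/
def rotate (r : Fin (n + 1)) : MvPolynomial (Fin g × Bool × Fin (n + 1)) k →ₐ[k]
    MvPolynomial (Fin g × Bool × Fin (n + 1)) k :=
  MvPolynomial.rename fun v => (v.1, v.2.1, v.2.2 + r)

theorem rotate_injective (r : Fin (n + 1)) :
    Function.Injective (rotate (k := k) (g := g) n r) := by
  refine MvPolynomial.rename_injective _ ?_
  rintro ⟨j, b, i⟩ ⟨j', b', i'⟩ h
  simpa using h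

theorem mapAlgHom_rotate_cyclePoly (r i : Fin (n + 1)) (w : List (Fin g)) :
    Polynomial.mapAlgHom (rotate n r) (cyclePoly k n i w) = cyclePoly k n (i + r) w := by
  induction w generalizing i with
  | nil => simp [cyclePoly]
  | cons j w ih =>
    have hi : i + 1 + r = i + r + 1 := add_right_comm i 1 r
    rw [cyclePoly, cyclePoly, map_add, map_mul, map_mul, map_mul, ih, ih, hi]
    simp [rotate]

theorem mapAlgHom_rotate_wordSum (r : Fin (n + 1)) (f : FreeAlgebra k (Fin g)) :
    Polynomial.mapAlgHom (rotate n r) (wordSum (cyclePoly k n 0) f)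
      = wordSum (cyclePoly k n r) f := by
  have := map_wordSum (Polynomial.mapAlgHom (rotate (k := k) (g := g) n r)).toLinearMap
    (cyclePoly k n 0) f
  simp only [AlgHom.toLinearMap_apply, mapAlgHom_rotate_cyclePoly, zero_add] at this
  exact this

theorem coeff_det_of_natDegree_le {R ι : Type*} [CommRing R] [Fintype ι] [DecidableEq ι]
    (M : Matrix ι ι (Polynomial R)) {m : ℕ} (h : ∀ i j, (M i j).natDegree ≤ m) :
    M.det.coeff (Fintype.card ι * m) = (M.map fun p => p.coeff m).det := by
  rw [Matrix.det_apply, Matrix.det_apply, Polynomial.finsetSum_coeff]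
  refine Finset.sum_congr rfl fun σ _ => ?_
  rw [Polynomial.coeff_smul]
  congr 1
  exact Polynomial.coeff_prod_of_natDegree_le _ _ _ fun i _ => h _ _

/-- If a noncommutative polynomial has a constant nonzero determinant on matrices of size `n + 1`,
then its cycle polynomial is constant. -/
theorem exists_wordSum_cyclePoly_eq_C {f : FreeAlgebra k (Fin g)}
    (h : IsUnit (polyEval f (n + 1)).det) :
    ∃ c : k, wordSum (cyclePoly k n 0) f = Polynomial.C (MvPolynomial.C c) := by
  obtain ⟨c, hc, hdet⟩ := MvPolynomial.isUnit_iff_eq_C_of_isReduced.mp h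
  have h1 := aeval_det_polyEval (cycleMatrix k n) f
  rw [hdet, MvPolynomial.aeval_C,
    IsScalarTower.algebraMap_apply k (MvPolynomial (Fin g × Bool × Fin (n + 1)) k),
    Polynomial.algebraMap_eq, MvPolynomial.algebraMap_eq] at h1
  set P := wordSum (cyclePoly k n 0) f with hP
  set m := P.natDegree with hm
  have hrot : ∀ r q, (wordSum (cyclePoly k n r) f).coeff q = rotate n r (P.coeff q) := by
    intro r q
    rw [← mapAlgHom_rotate_wordSum]
    simp [hP]
  have hdeg : ∀ i i', (FreeAlgebra.lift k (cycleMatrix k n) f i i').natDegree ≤ m := by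
    intro i i'
    rw [Polynomial.natDegree_le_iff_coeff_eq_zero]
    intro q hq
    rw [coeff_lift_cycleMatrix, hrot, Polynomial.coeff_eq_zero_of_natDegree_lt hq, map_zero,
      ite_self]
  have htop := coeff_det_of_natDegree_le _ hdeg
  -- The top coefficients form a monomial matrix: row `i` carries the rotated leading coefficient of
  -- `P`, in column `i + m`.
  have hmat : ((FreeAlgebra.lift k (cycleMatrix k n) f).map fun p => p.coeff m)
      = Matrix.diagonal (fun i => rotate n i (P.coeff m)) *
        (Equiv.addRight (Fin.ofNat (n + 1) m)).permMatrix _ := by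
    ext1 i i'
    rw [Matrix.diagonal_mul, Matrix.map_apply, coeff_lift_cycleMatrix, hrot]
    simp [Equiv.Perm.permMatrix, PEquiv.toMatrix_apply]
  rw [hmat, Matrix.det_mul, Matrix.det_diagonal, Matrix.det_permutation, ← h1,
    Polynomial.coeff_C] at htop
  have hunit : IsUnit (((Equiv.Perm.sign (Equiv.addRight (Fin.ofNat (n + 1) m)) : ℤˣ) : ℤ) :
      MvPolynomial (Fin g × Bool × Fin (n + 1)) k) :=
    (Units.isUnit _).map (Int.castRingHom _)
  by_cases hm0 : m = 0
  · rw [if_pos (by simp [hm0])] at htop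
    have hprod : IsUnit (∏ i, rotate n i (P.coeff m)) := by
      have : IsUnit (MvPolynomial.C c : MvPolynomial (Fin g × Bool × Fin (n + 1)) k) :=
        hc.map MvPolynomial.C
      rw [htop] at this
      exact isUnit_of_mul_isUnit_left this
    have h0 : IsUnit (rotate n 0 (P.coeff m)) :=
      isUnit_of_dvd_unit (Finset.dvd_prod_of_mem (fun i => rotate n i (P.coeff m)) (Finset.mem_univ 0)) hprod
    have hr0 : rotate n 0 (P.coeff m) = P.coeff m := by
      rw [rotate]
      convert MvPolynomial.rename_id_apply (P.coeff m) using 3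
      ext v <;> simp
    rw [hr0, hm0] at h0
    obtain ⟨c', -, hc'⟩ := MvPolynomial.isUnit_iff_eq_C_of_isReduced.mp h0
    refine ⟨c', ?_⟩
    rw [← hc']
    exact Polynomial.eq_C_of_natDegree_eq_zero (hm ▸ hm0)
  -- For `m > 0` the constant determinant has zero coefficient in degree `(n + 1) * m`, so a rotated
  -- leading coefficient vanishes, and rotation is injective.
  · exfalso
    rw [if_neg (by simp [hm0]), eq_comm, hunit.mul_left_eq_zero, Finset.prod_eq_zero_iff] at htop
    obtain ⟨i, -, hi⟩ := htop
    rw [map_eq_zero_iff _ (rotate_injective n i)] at hi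
    have : P = 0 := Polynomial.leadingCoeff_eq_zero.mp hi
    rw [this, Polynomial.natDegree_zero] at hm
    exact hm0 hm

/-- Cutting the cycle before the vertex `0`. -/
def cutCycle : Polynomial (MvPolynomial (Fin g × Bool × Fin (n + 1)) k) →ₐ[k]
    MvPolynomial (Fin g × Bool × ℕ) k :=
  (MvPolynomial.aeval fun v => if v.2.1 = true ∧ v.2.2 = Fin.last n then 0
    else MvPolynomial.X (v.1, v.2.1, (v.2.2 : ℕ))).comp
    ((Polynomial.aeval (1 : MvPolynomial (Fin g × Bool × Fin (n + 1)) k)).restrictScalars k)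

theorem cutCycle_cyclePoly (i : Fin (n + 1)) (w : List (Fin g)) :
    cutCycle n (cyclePoly k n i w) = walkPoly k n i w := by
  induction w generalizing i with
  | nil => simp [cyclePoly, walkPoly]
  | cons j w ih =>
    rw [cyclePoly, walkPoly, map_add, map_mul, map_mul, map_mul, ih, ih]
    have hX : cutCycle (k := k) (g := g) n Polynomial.X = 1 := by simp [cutCycle]
    have hf : cutCycle (k := k) n (Polynomial.C (MvPolynomial.X (j, false, i)))
        = MvPolynomial.X (j, false, (i : ℕ)) := by simp [cutCycle]
    rw [hX, hf]
    by_cases hi : i = Fin.last n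
    · have ht : cutCycle (k := k) n (Polynomial.C (MvPolynomial.X (j, true, i))) = 0 := by
        simp [cutCycle, hi]
      rw [ht, hi]
      simp
    · have ht : cutCycle (k := k) n (Polynomial.C (MvPolynomial.X (j, true, i)))
          = MvPolynomial.X (j, true, (i : ℕ)) := by
        simp [cutCycle, hi]
      have hlt : (i : ℕ) < n := Fin.val_lt_last hi
      rw [ht, if_pos hlt, one_mul, Fin.val_add_one_of_lt (Fin.lt_last_iff_ne_last.mpr hi)]

/-- A noncommutative polynomial of degree less than `2 n` whose determinant on `n × n` matrices is
a nonzero constant is constant. -/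
theorem isConstant_of_isUnit_det {n : ℕ} {f : FreeAlgebra k (Fin g)} (hf : ncDegree f < 2 * n)
    (h : IsUnit (polyEval f n).det) : IsConstant f := by
  classical
  obtain ⟨n, rfl⟩ : ∃ m, n = m + 1 := ⟨n - 1, by omega⟩
  obtain ⟨c, hc⟩ := exists_wordSum_cyclePoly_eq_C n h
  have hwalk : wordSum (walkPoly k n 0) f = MvPolynomial.C c := by
    have := map_wordSum (cutCycle (k := k) (g := g) n).toLinearMap (cyclePoly k n 0) f
    simp only [AlgHom.toLinearMap_apply, cutCycle_cyclePoly, Fin.val_zero] at this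
    rw [← this, hc]
    simp [cutCycle]
  refine isConstant_of_wordCoeff_eq_zero fun v hv => ?_
  by_cases hlen : ncDegree f < v.length
  · exact wordCoeff_eq_zero_of_ncDegree_lt hlen
  have := map_wordSum (MvPolynomial.lcoeff k (stair false 0 v)) (walkPoly k n 0) f
  simp only [MvPolynomial.lcoeff_apply] at this
  rw [hwalk, MvPolynomial.coeff_C, if_neg (stair_ne_zero false 0 hv).symm] at this
  refine Eq.trans ?_ this.symm
  rw [← wordSum_ite]
  congr 1
  funext w
  -- The size is now `n + 1`, so the degree bound reads `2n + 1`, exactly the capacity of the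
  -- staircase.
  rw [coeff_stair_walkPoly k n v w false 0 (by omega) (by simp; omega)]

/-- A noncommutative polynomial of degree at least `2` with an irreducible determinant on `n × n`
matrices, where `2 n` is at least the degree, is an atom. -/
theorem isPolyAtom_of_irreducible_det {n : ℕ} {f : FreeAlgebra k (Fin g)} (hf : 1 < ncDegree f)
    (hn : ncDegree f ≤ 2 * n) (h : Irreducible (polyEval f n).det) : IsPolyAtom f := by
  refine ⟨fun hc => ?_, ?_⟩
  · rw [ncDegree_eq_zero_of_isConstant hc] at hf
    omega
  · rintro ⟨f₁, f₂, h₁, h₂, rfl⟩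
    have hz : ∀ {p : FreeAlgebra k (Fin g)}, ¬ IsConstant p → p ≠ 0 := by
      rintro p hp rfl
      exact hp ⟨0, (map_zero _).symm⟩
    have hdeg := ncDegree_add_le_ncDegree_mul (hz h₁) (hz h₂)
    have hd₁ : ncDegree f₁ ≠ 0 := fun h0 => h₁ (isConstant_of_ncDegree_eq_zero h0)
    have hd₂ : ncDegree f₂ ≠ 0 := fun h0 => h₂ (isConstant_of_ncDegree_eq_zero h0)
    have hmul : (polyEval (f₁ * f₂) n).det = (polyEval f₁ n).det * (polyEval f₂ n).det := by
      rw [polyEval, map_mul, Matrix.det_mul]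
      rfl
    rcases h.isUnit_or_isUnit hmul with hu | hu
    · exact h₁ (isConstant_of_isUnit_det (by omega) hu)
    · exact h₂ (isConstant_of_isUnit_det (by omega) hu)

end Cyclic

/-! ### Removing the last letter. -/

section Strip

variable {k : Type*} [Field k] {g : ℕ}

/-- The constant term of a noncommutative polynomial. -/
def aug (k : Type*) [Field k] (g : ℕ) : FreeAlgebra k (Fin g) →ₐ[k] k :=
  FreeAlgebra.lift k fun _ => 0

/-- The representation whose off-diagonal entry removes a last letter `x_j`. -/
def stripRep (k : Type*) [Field k] {g : ℕ} (j : Fin g) :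
    FreeAlgebra k (Fin g) →ₐ[k] Matrix (Fin 2) (Fin 2) (FreeAlgebra k (Fin g)) :=
  FreeAlgebra.lift k fun i => !![FreeAlgebra.ι k i, if i = j then 1 else 0; 0, 0]

/-- The coefficient of `x_j` when a noncommutative polynomial is written as
`c + ∑ j, a_j * x_j`. -/
def strip (j : Fin g) : FreeAlgebra k (Fin g) →ₗ[k] FreeAlgebra k (Fin g) where
  toFun a := stripRep k j a 0 1
  map_add' a b := by simp
  map_smul' c a := by simp

theorem stripRep_eq (j : Fin g) (a : FreeAlgebra k (Fin g)) :
    stripRep k j a = !![a, strip j a; 0, algebraMap k _ (aug k g a)] := by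
  have key : stripRep k j a 0 0 = a ∧ stripRep k j a 1 0 = 0 ∧
      stripRep k j a 1 1 = algebraMap k _ (aug k g a) := by
    induction a using FreeAlgebra.induction with
    | grade0 r => simp [Matrix.algebraMap_matrix_apply]
    | grade1 i => simp [stripRep, aug]
    | mul a b ha hb =>
      obtain ⟨h1, h2, h3⟩ := ha
      obtain ⟨h4, h5, h6⟩ := hb
      simp [Matrix.mul_apply, Fin.sum_univ_two, *]
    | add a b ha hb =>
      obtain ⟨h1, h2, h3⟩ := ha
      obtain ⟨h4, h5, h6⟩ := hb
      simp [*]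
  obtain ⟨h1, h2, h3⟩ := key
  ext p q
  fin_cases p <;> fin_cases q <;> simp [h1, h2, h3, strip]

/-- The twisted Leibniz rule is the off-diagonal entry of a product of upper triangular `2 × 2`
matrices. -/
theorem strip_mul (j : Fin g) (a b : FreeAlgebra k (Fin g)) :
    strip j (a * b) = a * strip j b + strip j a * algebraMap k _ (aug k g b) := by
  have h : strip j (a * b) = (stripRep k j a * stripRep k j b) 0 1 := by
    rw [← map_mul]; rfl
  rw [h, stripRep_eq, stripRep_eq]
  simp [Matrix.mul_apply, Fin.sum_univ_two]

@[simp]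
theorem strip_algebraMap (j : Fin g) (c : k) :
    strip j (algebraMap k (FreeAlgebra k (Fin g)) c) = 0 := by
  have h : strip j (algebraMap k (FreeAlgebra k (Fin g)) c) = stripRep k j (algebraMap k _ c) 0 1 :=
    rfl
  rw [h, AlgHom.commutes]
  simp [Matrix.algebraMap_matrix_apply]

@[simp]
theorem strip_ι (i j : Fin g) : strip (k := k) j (FreeAlgebra.ι k i) = if i = j then 1 else 0 := by
  have h : strip (k := k) j (FreeAlgebra.ι k i) = stripRep k j (FreeAlgebra.ι k i) 0 1 := rfl
  rw [h]
  simp [stripRep]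

@[simp]
theorem aug_ι (i : Fin g) : aug k g (FreeAlgebra.ι k i) = 0 := by
  simp [aug]

theorem strip_mul_ι (i j : Fin g) (a : FreeAlgebra k (Fin g)) :
    strip j (a * FreeAlgebra.ι k i) = if i = j then a else 0 := by
  rw [strip_mul]
  simp

theorem eq_aug_add_sum_strip (a : FreeAlgebra k (Fin g)) :
    a = algebraMap k _ (aug k g a) + ∑ j, strip j a * FreeAlgebra.ι k j := by
  induction a using FreeAlgebra.induction with
  | grade0 r => simp
  | grade1 i => simp
  | mul a b ha hb =>
    conv_lhs => rw [hb, mul_add, Finset.mul_sum]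
    simp only [strip_mul, add_mul, Finset.sum_add_distrib, map_mul]
    rw [add_comm (∑ j, a * strip j b * FreeAlgebra.ι k j), ← add_assoc]
    congr 1
    · conv_lhs => rw [ha, add_mul, Finset.sum_mul]
      congr 1
      refine Finset.sum_congr rfl fun j _ => ?_
      rw [mul_assoc, mul_assoc, ← Algebra.commutes]
    · simp only [mul_assoc]
  | add a b ha hb =>
    conv_lhs => rw [ha, hb]
    simp only [map_add, add_mul, Finset.sum_add_distrib]
    abel

/-- Removing any `N` last letters yields zero: the degree is less than `N`. -/
def DegLT : ℕ → FreeAlgebra k (Fin g) → Prop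
  | 0, a => a = 0
  | N + 1, a => ∀ j, DegLT N (strip j a)

theorem degLT_zero_right (N : ℕ) : DegLT N (0 : FreeAlgebra k (Fin g)) := by
  induction N with
  | zero => rfl
  | succ N ih => intro j; rw [map_zero]; exact ih

theorem DegLT.succ {N : ℕ} {a : FreeAlgebra k (Fin g)} (h : DegLT N a) : DegLT (N + 1) a := by
  induction N generalizing a with
  | zero => rw [show a = 0 from h]; exact degLT_zero_right 1
  | succ N ih => exact fun j => ih (h j)

theorem DegLT.mono {N M : ℕ} (hNM : N ≤ M) {a : FreeAlgebra k (Fin g)} (h : DegLT N a) :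
    DegLT M a := by
  induction hNM with
  | refl => exact h
  | step _ ih => exact ih.succ

theorem DegLT.add {N : ℕ} {a b : FreeAlgebra k (Fin g)} (ha : DegLT N a) (hb : DegLT N b) :
    DegLT N (a + b) := by
  induction N generalizing a b with
  | zero => rw [show a = 0 from ha, show b = 0 from hb, add_zero]; rfl
  | succ N ih => intro j; rw [map_add]; exact ih (ha j) (hb j)

theorem DegLT.mul_algebraMap {N : ℕ} {a : FreeAlgebra k (Fin g)} (ha : DegLT N a) (c : k) :
    DegLT N (a * algebraMap k _ c) := by
  induction N generalizing a with
  | zero => rw [show a = 0 from ha, zero_mul]; rfl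
  | succ N ih =>
    intro j
    rw [strip_mul, strip_algebraMap, mul_zero, zero_add, AlgHom.commutes]
    exact ih (ha j)

theorem degLT_one_algebraMap (c : k) : DegLT 1 (algebraMap k (FreeAlgebra k (Fin g)) c) :=
  fun j => strip_algebraMap j c

theorem exists_degLT (a : FreeAlgebra k (Fin g)) : ∃ N, DegLT N a := by
  have key : ∀ b : FreeAlgebra k (Fin g), (∃ N, DegLT N b) → ∃ N, DegLT N (b * a) := by
    induction a using FreeAlgebra.induction with
    | grade0 r => exact fun b ⟨N, hN⟩ => ⟨N, hN.mul_algebraMap r⟩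
    | grade1 i =>
      refine fun b ⟨N, hN⟩ => ⟨N + 1, fun j => ?_⟩
      rw [strip_mul_ι]
      split_ifs
      · exact hN
      · exact degLT_zero_right N
    | mul a a' ha ha' => exact fun b hb => by rw [← mul_assoc]; exact ha' _ (ha b hb)
    | add a a' ha ha' =>
      intro b hb
      obtain ⟨N, hN⟩ := ha b hb
      obtain ⟨M, hM⟩ := ha' b hb
      rw [mul_add]
      exact ⟨max N M, (hN.mono (le_max_left _ _)).add (hM.mono (le_max_right _ _))⟩
  have := key 1 ⟨1, by
    simpa only [map_one] using degLT_one_algebraMap (g := g) (1 : k)⟩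
  rwa [one_mul] at this

/-- A set of noncommutative polynomials without constant terms that is stable under removing last
letters consists of zero only. -/
theorem eq_zero_of_forall_strip {S : Set (FreeAlgebra k (Fin g))} (h0 : ∀ a ∈ S, aug k g a = 0)
    (hS : ∀ a ∈ S, ∀ j, strip j a ∈ S) {a : FreeAlgebra k (Fin g)} (ha : a ∈ S) : a = 0 := by
  obtain ⟨N, hN⟩ := exists_degLT a
  induction N generalizing a with
  | zero => exact hN
  | succ N ih =>
    rw [eq_aug_add_sum_strip a, h0 a ha, map_zero, zero_add]
    exact Finset.sum_eq_zero fun j _ => by rw [ih (hS a ha j) (hN j), zero_mul]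

end Strip

/-! ### Column spaces over the free algebra and factors of a pencil. -/

section Vectors

variable {k : Type*} [Field k] {g d : ℕ}

/-- A constant vector over the free algebra. -/
def constVec (g : ℕ) (v : Fin d → k) : Fin d → FreeAlgebra k (Fin g) := fun p => algebraMap k _ (v p)

/-- The constant term of a vector. -/
def augVec (u : Fin d → FreeAlgebra k (Fin g)) : Fin d → k := fun p => aug k g (u p)

/-- Removing a last letter from every entry of a vector. -/
def stripVec (j : Fin g) (u : Fin d → FreeAlgebra k (Fin g)) : Fin d → FreeAlgebra k (Fin g) :=
  fun p => strip j (u p)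

/-- The constant term of a matrix. -/
def augMat (F : Matrix (Fin d) (Fin d) (FreeAlgebra k (Fin g))) : Matrix (Fin d) (Fin d) k :=
  (aug k g).mapMatrix F

/-- Right multiplication of a vector by a letter. -/
def mulLetter (u : Fin d → FreeAlgebra k (Fin g)) (j : Fin g) : Fin d → FreeAlgebra k (Fin g) :=
  fun p => u p * FreeAlgebra.ι k j

theorem augVec_mulVec (F : Matrix (Fin d) (Fin d) (FreeAlgebra k (Fin g)))
    (u : Fin d → FreeAlgebra k (Fin g)) : augVec (F.mulVec u) = (augMat F).mulVec (augVec u) := by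
  ext p
  simp [augVec, augMat, Matrix.mulVec, dotProduct]

theorem eq_const_add_sum (u : Fin d → FreeAlgebra k (Fin g)) :
    u = constVec g (augVec u) + ∑ j, mulLetter (stripVec j u) j := by
  ext p
  rw [Pi.add_apply, Finset.sum_apply]
  exact eq_aug_add_sum_strip (u p)

theorem stripVec_mulVec (j : Fin g) (F : Matrix (Fin d) (Fin d) (FreeAlgebra k (Fin g)))
    {u : Fin d → FreeAlgebra k (Fin g)} (hu : augVec u = 0) :
    stripVec j (F.mulVec u) = F.mulVec (stripVec j u) := by
  ext p
  simp only [stripVec, Matrix.mulVec, dotProduct, map_sum, strip_mul]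
  refine Finset.sum_congr rfl fun q _ => ?_
  have : aug k g (u q) = 0 := congrFun hu q
  rw [this, map_zero, mul_zero, add_zero]

theorem augVec_eq_zero {F : Matrix (Fin d) (Fin d) (FreeAlgebra k (Fin g))}
    (hF : IsUnit (augMat F)) {u : Fin d → FreeAlgebra k (Fin g)} (h : augVec (F.mulVec u) = 0) :
    augVec u = 0 := by
  rw [augVec_mulVec] at h
  exact Matrix.mulVec_injective_of_isUnit hF (by rw [h, Matrix.mulVec_zero])

theorem exists_degLT_vec (u : Fin d → FreeAlgebra k (Fin g)) : ∃ N, ∀ p, DegLT N (u p) := by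
  choose N hN using fun p => exists_degLT (u p)
  exact ⟨Finset.univ.sup N, fun p => (hN p).mono (Finset.le_sup (Finset.mem_univ p))⟩

/-- A matrix with an invertible constant term is injective. -/
theorem eq_zero_of_mulVec_eq_zero {F : Matrix (Fin d) (Fin d) (FreeAlgebra k (Fin g))}
    (hF : IsUnit (augMat F)) {u : Fin d → FreeAlgebra k (Fin g)} (h : F.mulVec u = 0) : u = 0 := by
  obtain ⟨N, hN⟩ := exists_degLT_vec u
  induction N generalizing u with
  | zero => exact funext hN
  | succ N ih =>
    have h0 : augVec u = 0 := augVec_eq_zero hF (by rw [h]; ext p; simp [augVec])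
    have hs : ∀ j, stripVec j u = 0 := fun j => by
      refine ih ?_ fun p => hN p j
      rw [← stripVec_mulVec j F h0, h]
      ext p
      simp [stripVec]
    rw [eq_const_add_sum u, h0]
    ext p
    simp [hs, constVec, mulLetter]

theorem eq_zero_of_mul_eq_zero {F G : Matrix (Fin d) (Fin d) (FreeAlgebra k (Fin g))}
    (hF : IsUnit (augMat F)) (h : F * G = 0) : G = 0 := by
  ext p q
  have : F.mulVec (fun r => G r q) = 0 := by
    ext r
    exact congrFun (congrFun h r) q
  exact congrFun (eq_zero_of_mulVec_eq_zero hF this) p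

theorem augMat_mul (F G : Matrix (Fin d) (Fin d) (FreeAlgebra k (Fin g))) :
    augMat (F * G) = augMat F * augMat G := map_mul _ _ _

theorem augMat_one : augMat (1 : Matrix (Fin d) (Fin d) (FreeAlgebra k (Fin g))) = 1 := map_one _

/-- A right invertible matrix over the free algebra is invertible. -/
theorem isUnit_of_mul_eq_one {F G : Matrix (Fin d) (Fin d) (FreeAlgebra k (Fin g))}
    (h : F * G = 1) : IsUnit F := by
  have hF : IsUnit (augMat F) := by
    refine IsUnit.of_mul_eq_one (augMat G) ?_
    rw [← augMat_mul, h, augMat_one]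
  have h' : G * F - 1 = 0 := by
    refine eq_zero_of_mul_eq_zero hF ?_
    rw [mul_sub, ← mul_assoc, h, one_mul, mul_one, sub_self]
  exact ⟨⟨F, G, h, sub_eq_zero.mp h'⟩, rfl⟩

theorem isUnit_of_forall_const {F : Matrix (Fin d) (Fin d) (FreeAlgebra k (Fin g))}
    (h : ∀ v : Fin d → k, ∃ r, F.mulVec r = constVec g v) : IsUnit F := by
  choose r hr using fun q : Fin d => h (Pi.single q 1)
  refine isUnit_of_mul_eq_one (G := Matrix.of fun p q => r q p) ?_
  ext p q
  have := congrFun (hr q) p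
  simp only [Matrix.mulVec, dotProduct, constVec] at this
  simp only [Matrix.mul_apply, Matrix.of_apply, this, Matrix.one_apply, Pi.single_apply]
  split_ifs <;> simp

variable (A : Fin g → Matrix (Fin d) (Fin d) k)

theorem augMat_monicPencil : augMat (monicPencil A) = 1 := by
  ext p q
  simp [augMat, monicPencil, Matrix.sum_apply, Matrix.one_apply, apply_ite]

theorem strip_monicPencil (j : Fin g) (p q : Fin d) :
    strip j (monicPencil A p q) = - algebraMap k _ (A j p q) := by
  have h1 : strip j ((1 : Matrix (Fin d) (Fin d) (FreeAlgebra k (Fin g))) p q) = 0 := by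
    rw [Matrix.one_apply]
    split_ifs
    · rw [← map_one (algebraMap k _), strip_algebraMap]
    · simp
  simp [monicPencil, Matrix.sub_apply, Matrix.sum_apply, h1, Algebra.algebraMap_eq_smul_one]

theorem isRegular_monicPencil : IsRegular (monicPencil A) := by
  have hL : IsUnit (augMat (monicPencil A)) := by rw [augMat_monicPencil]; exact isUnit_one
  rw [isRegular_iff]
  constructor
  · intro M M' h
    refine sub_eq_zero.mp (eq_zero_of_mul_eq_zero hL ?_)
    rw [mul_sub, sub_eq_zero]
    exact h
  · intro M M' h
    rw [← sub_eq_zero]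
    set Y := M - M' with hY
    have hYL : Y * monicPencil A = 0 := by
      rw [hY, sub_mul, sub_eq_zero]
      exact h
    have haug : ∀ p q, aug k g (Y p q) = 0 := by
      have : augMat Y = 0 := by
        have := augMat_mul Y (monicPencil A)
        rw [hYL, augMat_monicPencil, mul_one] at this
        rw [← this]
        exact map_zero _
      intro p q
      exact congrFun (congrFun this p) q
    -- Comparing last letters in `Y * L = 0` shows that stripping `x_j` from `Y` amounts to right
    -- multiplication by `A j`. Hence the constant combinations of a row of `Y` are stable under
    -- stripping and have no constant term.
    have hstrip : ∀ j p q, strip j (Y p q) = ∑ r, Y p r * algebraMap k _ (A j r q) := by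
      intro j p q
      have h1 := congrArg (strip j) (congrFun (congrFun hYL p) q)
      rw [Matrix.mul_apply, map_sum] at h1
      simp only [strip_mul, strip_monicPencil, mul_neg, Finset.sum_add_distrib,
        Finset.sum_neg_distrib, Matrix.zero_apply, map_zero] at h1
      have h2 : ∑ r, strip j (Y p r) * algebraMap k _ (aug k g (monicPencil A r q))
          = strip j (Y p q) := by
        have : ∀ r, aug k g (monicPencil A r q) = (1 : Matrix (Fin d) (Fin d) k) r q := fun r =>
          congrFun (congrFun (augMat_monicPencil A) r) q
        simp [this, Matrix.one_apply]
      rw [h2, neg_add_eq_zero] at h1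
      exact h1.symm
    ext p q
    refine eq_zero_of_forall_strip
      (S := {a | ∃ c : Fin d → k, a = ∑ r, Y p r * algebraMap k _ (c r)}) ?_ ?_ ?_
    · rintro a ⟨c, rfl⟩
      simp [haug]
    · rintro a ⟨c, rfl⟩ j
      refine ⟨(A j).mulVec c, ?_⟩
      simp only [map_sum, strip_mul, strip_algebraMap, mul_zero, zero_add, AlgHom.commutes, hstrip,
        Algebra.algebraMap_self_apply, Matrix.mulVec, dotProduct, map_mul, Finset.mul_sum, Finset.sum_mul, mul_assoc]
      exact Finset.sum_comm
    · refine ⟨Pi.single q 1, ?_⟩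
      rw [Finset.sum_eq_single q]
      · simp
      · intro r _ hr; simp [hr]
      · simp

/-- The coefficient of `x_j` of a vector modulo the column space of a monic pencil. -/
def reduceVec (j : Fin g) (u : Fin d → FreeAlgebra k (Fin g)) : Fin d → FreeAlgebra k (Fin g) :=
  constVec g ((A j).mulVec (augVec u)) + stripVec j u

theorem monicPencil_mulVec_const (v : Fin d → k) :
    (monicPencil A).mulVec (constVec g v)
      = constVec g v - ∑ j, mulLetter (constVec g ((A j).mulVec v)) j := by
  ext p
  simp only [monicPencil, Matrix.sub_mulVec, Matrix.one_mulVec, Pi.sub_apply, Finset.sum_apply,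
    Matrix.sum_mulVec]
  congr 1
  refine Finset.sum_congr rfl fun j _ => ?_
  simp only [Matrix.mulVec, dotProduct, Matrix.map_apply, constVec, mulLetter, map_sum, map_mul,
    Finset.sum_mul]
  refine Finset.sum_congr rfl fun q _ => ?_
  rw [Algebra.smul_def, mul_assoc, mul_assoc, ← Algebra.commutes]

theorem eq_monicPencil_mulVec_add_sum (u : Fin d → FreeAlgebra k (Fin g)) :
    u = (monicPencil A).mulVec (constVec g (augVec u)) + ∑ j, mulLetter (reduceVec A j u) j := by
  rw [monicPencil_mulVec_const]
  conv_lhs => rw [eq_const_add_sum u]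
  have : ∀ j, mulLetter (reduceVec A j u) j = mulLetter (constVec g ((A j).mulVec (augVec u))) j
      + mulLetter (stripVec j u) j := by
    intro j
    ext p
    simp [mulLetter, reduceVec, add_mul]
  simp only [this, Finset.sum_add_distrib]
  abel

theorem augVec_const (v : Fin d → k) : augVec (constVec g v) = v := by
  ext p; simp [augVec, constVec]

theorem reduceVec_const (j : Fin g) (v : Fin d → k) :
    reduceVec A j (constVec g v) = constVec g ((A j).mulVec v) := by
  rw [reduceVec, augVec_const]
  ext p
  simp [stripVec, constVec]

theorem mulVec_mulLetter (F : Matrix (Fin d) (Fin d) (FreeAlgebra k (Fin g)))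
    (u : Fin d → FreeAlgebra k (Fin g)) (j : Fin g) :
    F.mulVec (mulLetter u j) = mulLetter (F.mulVec u) j := by
  ext p
  simp [Matrix.mulVec, dotProduct, mulLetter, Finset.sum_mul, mul_assoc]

variable {A}

/-- Modulo the column space of the pencil, which lies in that of `F`, the vector `u` is the sum of
its reductions times the letters. -/
theorem exists_mulVec_eq_of_reduceVec {F G : Matrix (Fin d) (Fin d) (FreeAlgebra k (Fin g))}
    (hFG : monicPencil A = F * G) {u : Fin d → FreeAlgebra k (Fin g)}
    (h : ∀ j, ∃ r, F.mulVec r = reduceVec A j u) : ∃ r, F.mulVec r = u := by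
  choose r hr using h
  refine ⟨G.mulVec (constVec g (augVec u)) + ∑ j, mulLetter (r j) j, ?_⟩
  conv_rhs => rw [eq_monicPencil_mulVec_add_sum A u]
  rw [Matrix.mulVec_add, Matrix.mulVec_mulVec, ← hFG, Matrix.mulVec_sum]
  simp only [mulVec_mulLetter, hr]

theorem isUnit_augMat_left {F G : Matrix (Fin d) (Fin d) (FreeAlgebra k (Fin g))}
    (hFG : monicPencil A = F * G) : IsUnit (augMat F) := by
  refine IsUnit.of_mul_eq_one (augMat G) ?_
  rw [← augMat_mul, ← hFG, augMat_monicPencil]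

/-- After subtracting a vector in the column space of the pencil, the image under `F` has no
constant term. Since the constant term of `F` is invertible, neither has the preimage, so stripping
commutes with `F`. -/
theorem exists_mulVec_eq_reduceVec {F G : Matrix (Fin d) (Fin d) (FreeAlgebra k (Fin g))}
    (hFG : monicPencil A = F * G) {u : Fin d → FreeAlgebra k (Fin g)}
    (h : ∃ r, F.mulVec r = u) (j : Fin g) : ∃ r, F.mulVec r = reduceVec A j u := by
  obtain ⟨r, hr⟩ := h
  set s := r - G.mulVec (constVec g (augVec u)) with hs
  have hFs : F.mulVec s = ∑ j, mulLetter (reduceVec A j u) j := by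
    rw [hs, Matrix.mulVec_sub, hr, Matrix.mulVec_mulVec, ← hFG, sub_eq_iff_eq_add']
    exact eq_monicPencil_mulVec_add_sum A u
  have h0 : augVec s = 0 := by
    refine augVec_eq_zero (isUnit_augMat_left hFG) ?_
    rw [hFs]
    ext p
    simp [augVec, mulLetter]
  refine ⟨stripVec j s, ?_⟩
  rw [← stripVec_mulVec j F h0, hFs]
  ext p
  simp [stripVec, mulLetter, strip_mul_ι]

theorem exists_mulVec_eq_const_of_words {F G : Matrix (Fin d) (Fin d) (FreeAlgebra k (Fin g))}
    (hFG : monicPencil A = F * G) (N : ℕ) {v : Fin d → k}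
    (h : ∀ w : List (Fin g), w.length = N →
      ∃ r, F.mulVec r = constVec g ((w.map A).prod.mulVec v)) :
    ∃ r, F.mulVec r = constVec g v := by
  induction N generalizing v with
  | zero => simpa using h [] rfl
  | succ N ih =>
    refine exists_mulVec_eq_of_reduceVec hFG fun j => ?_
    rw [reduceVec_const]
    refine ih fun w hw => ?_
    have := h (w ++ [j]) (by simp [hw])
    simpa [Matrix.mulVec_mulVec] using this

/-- The constant vectors in the column space of a matrix. -/
def constRange (F : Matrix (Fin d) (Fin d) (FreeAlgebra k (Fin g))) : Submodule k (Fin d → k) where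
  carrier := {v | ∃ r, F.mulVec r = constVec g v}
  zero_mem' := ⟨0, by ext p; simp [constVec]⟩
  add_mem' := by
    rintro v v' ⟨r, hr⟩ ⟨r', hr'⟩
    refine ⟨r + r', ?_⟩
    rw [Matrix.mulVec_add, hr, hr']
    ext p
    simp [constVec]
  smul_mem' := by
    rintro c v ⟨r, hr⟩
    refine ⟨c • r, ?_⟩
    rw [Matrix.mulVec_smul, hr]
    ext p
    simp [constVec, Algebra.smul_def]

theorem mem_constRange {F : Matrix (Fin d) (Fin d) (FreeAlgebra k (Fin g))} {v : Fin d → k} :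
    v ∈ constRange F ↔ ∃ r, F.mulVec r = constVec g v := Iff.rfl

/-- The reduction of a constant vector `v` at `x_j` is the constant vector `A j v`. -/
theorem mulVec_mem_constRange {F G : Matrix (Fin d) (Fin d) (FreeAlgebra k (Fin g))}
    (hFG : monicPencil A = F * G) (j : Fin g) {v : Fin d → k} (hv : v ∈ constRange F) :
    (A j).mulVec v ∈ constRange F := by
  rw [mem_constRange, ← reduceVec_const]
  exact exists_mulVec_eq_reduceVec hFG hv j

/-- If the coefficients of a pencil are jointly nilpotent modulo the constant column space of its
left factor, then the left factor is invertible. -/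
theorem isUnit_left_of_words_mem {F G : Matrix (Fin d) (Fin d) (FreeAlgebra k (Fin g))}
    (hFG : monicPencil A = F * G) {N : ℕ}
    (h : ∀ w : List (Fin g), w.length = N → ∀ v, (w.map A).prod.mulVec v ∈ constRange F) :
    IsUnit F :=
  isUnit_of_forall_const fun v =>
    exists_mulVec_eq_const_of_words hFG N fun w hw => h w hw v

/-- If the coefficients of a pencil are jointly nilpotent on the constant column space of its left
factor, then the right factor is invertible. -/
theorem isUnit_right_of_words_eq_zero {F G : Matrix (Fin d) (Fin d) (FreeAlgebra k (Fin g))}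
    (hFG : monicPencil A = F * G) {N : ℕ}
    (h : ∀ w : List (Fin g), w.length = N → ∀ v ∈ constRange F, (w.map A).prod.mulVec v = 0) :
    IsUnit G := by
  -- With this trivial factorization the reduction lemmas apply to the column space of the pencil
  -- itself.
  have hLL : monicPencil A = monicPencil A * 1 := (mul_one _).symm
  have hconst : ∀ v ∈ constRange F, ∃ r, (monicPencil A).mulVec r = constVec g v := fun v hv =>
    exists_mulVec_eq_const_of_words hLL N fun w hw => by
      rw [h w hw v hv]
      exact ⟨0, by ext p; simp [constVec]⟩
  -- Reduction lowers the degree and stays in the column space of `F`, down to constants, which lie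
  -- in that of the pencil by nilpotency. So the two column spaces coincide.
  have hrange : ∀ (M : ℕ) (u : Fin d → FreeAlgebra k (Fin g)), (∀ p, DegLT (M + 1) (u p)) →
      (∃ r, F.mulVec r = u) → ∃ r, (monicPencil A).mulVec r = u := by
    intro M
    induction M with
    | zero =>
      intro u hu hr
      have huc : u = constVec g (augVec u) := by
        conv_lhs => rw [eq_const_add_sum u]
        have hz : ∀ j, stripVec j u = 0 := fun j => funext fun p => hu p j
        ext p
        simp [hz, mulLetter]
      rw [huc] at hr ⊢
      exact hconst _ hr
    | succ M ih =>
      intro u hu hr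
      refine exists_mulVec_eq_of_reduceVec hLL fun j => ?_
      refine ih _ (fun p => ?_) (exists_mulVec_eq_reduceVec hFG hr j)
      exact ((degLT_one_algebraMap _).mono (by omega)).add (hu p j)
  have hall : ∀ q : Fin d, ∃ r, (monicPencil A).mulVec r = fun p => F p q := by
    intro q
    obtain ⟨M, hM⟩ := exists_degLT_vec fun p => F p q
    refine hrange M _ (fun p => (hM p).succ) ⟨Pi.single q 1, ?_⟩
    rw [Matrix.mulVec_single_one]
    rfl
  choose r hr using hall
  set H : Matrix (Fin d) (Fin d) (FreeAlgebra k (Fin g)) := Matrix.of fun p q => r q p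
  have hH : monicPencil A * H = F := by
    ext p q
    exact congrFun (hr q) p
  refine isUnit_of_mul_eq_one (G := H) (sub_eq_zero.mp ?_)
  refine eq_zero_of_mul_eq_zero (isUnit_augMat_left hFG) ?_
  rw [mul_sub, ← mul_assoc, ← hFG, hH, mul_one, sub_self]

end Vectors

/-! ### Restricted and quotient pencils of an invariant subspace. -/

section Invariant

variable {k : Type*} [Field k] {g d : ℕ}

/-- The matrices of the restrictions of `A` to an invariant subspace. -/
def restrictTuple (A : Fin g → Matrix (Fin d) (Fin d) k) {W : Submodule k (Fin d → k)}
    (hW : ∀ j, W ≤ W.comap (Matrix.toLin' (A j))) (j : Fin g) :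
    Matrix (Fin (Module.finrank k W)) (Fin (Module.finrank k W)) k :=
  LinearMap.toMatrix (Module.finBasis k W) (Module.finBasis k W)
    ((Matrix.toLin' (A j)).restrict (hW j))

/-- The matrices that `A` induces on the quotient by an invariant subspace. -/
def quotientTuple (A : Fin g → Matrix (Fin d) (Fin d) k) {W : Submodule k (Fin d → k)}
    (hW : ∀ j, W ≤ W.comap (Matrix.toLin' (A j))) (j : Fin g) :
    Matrix (Fin (Module.finrank k ((Fin d → k) ⧸ W))) (Fin (Module.finrank k ((Fin d → k) ⧸ W))) k :=
  LinearMap.toMatrix (Module.finBasis k ((Fin d → k) ⧸ W)) (Module.finBasis k ((Fin d → k) ⧸ W))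
    (W.mapQ W (Matrix.toLin' (A j)) (hW j))

variable {A : Fin g → Matrix (Fin d) (Fin d) k} {W : Submodule k (Fin d → k)}
  (hW : ∀ j, W ≤ W.comap (Matrix.toLin' (A j)))

theorem exists_toMatrix_eq_fromBlocks (j : Fin g) :
    ∃ B, LinearMap.toMatrix
      (Module.Basis.sumQuot (Module.finBasis k W) (Module.finBasis k ((Fin d → k) ⧸ W)))
      (Module.Basis.sumQuot (Module.finBasis k W) (Module.finBasis k ((Fin d → k) ⧸ W)))
      (Matrix.toLin' (A j)) = Matrix.fromBlocks (restrictTuple A hW j) B 0 (quotientTuple A hW j) := by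
  set bW := Module.finBasis k W
  set bQ := Module.finBasis k ((Fin d → k) ⧸ W)
  refine ⟨Matrix.of fun i l => (Module.Basis.sumQuot bW bQ).repr
    (Matrix.toLin' (A j) (Module.Basis.sumQuot bW bQ (Sum.inr l))) (Sum.inl i), ?_⟩
  ext u v
  cases u with
  | inl i =>
    cases v with
    | inl l =>
      rw [LinearMap.toMatrix_apply, Module.Basis.sumQuot_inl, Matrix.fromBlocks_apply₁₁,
        Module.Basis.sumQuot_repr_inl_of_mem bW bQ _ (hW j (bW l).2), restrictTuple,
        LinearMap.toMatrix_apply]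
      rfl
    | inr l => rw [LinearMap.toMatrix_apply, Matrix.fromBlocks_apply₁₂, Matrix.of_apply]
  | inr i =>
    cases v with
    | inl l =>
      rw [LinearMap.toMatrix_apply, Module.Basis.sumQuot_inl, Matrix.fromBlocks_apply₂₁,
        Module.Basis.sumQuot_repr_inr_of_mem bW bQ _ (hW j (bW l).2), Matrix.zero_apply]
    | inr l =>
      rw [LinearMap.toMatrix_apply, Matrix.fromBlocks_apply₂₂, Module.Basis.sumQuot_repr_inr,
        quotientTuple, LinearMap.toMatrix_apply, ← Module.Basis.sumQuot_inr bW bQ l, W.mapQ_apply,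
        Submodule.mkQ_apply]

/-- The determinant of a pencil with a nontrivial invariant subspace factors. -/
theorem det_pencilEval_eq_mul (n : ℕ) : (pencilEval A n).det =
    (pencilEval (restrictTuple A hW) n).det * (pencilEval (quotientTuple A hW) n).det := by
  set b := Module.Basis.sumQuot (Module.finBasis k W) (Module.finBasis k ((Fin d → k) ⧸ W))
  choose B hB using exists_toMatrix_eq_fromBlocks hW
  set N := fun j => Matrix.fromBlocks (restrictTuple A hW j) (B j) 0 (quotientTuple A hW j)
  let e := Pi.basisFun k (Fin d)
  have hA : ∀ j, A j = e.toMatrix b * N j * b.toMatrix e := by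
    intro j
    rw [show N j = _ from (hB j).symm, basis_toMatrix_mul_linearMap_toMatrix_mul_basis_toMatrix]
    simp [e, LinearMap.toMatrix_eq_toMatrix']
  have hinv : b.toMatrix e * e.toMatrix b = 1 := Module.Basis.toMatrix_mul_toMatrix_flip b e
  let c : k →+* MvPolynomial (Fin g × Fin n × Fin n) k := MvPolynomial.C
  set P := (e.toMatrix b).map c ⊗ₖ (1 : Matrix (Fin n) (Fin n) (MvPolynomial (Fin g × Fin n × Fin n) k))
  set Q := (b.toMatrix e).map c ⊗ₖ (1 : Matrix (Fin n) (Fin n) (MvPolynomial (Fin g × Fin n × Fin n) k))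
  set Z := ∑ j, (N j).map c ⊗ₖ genericMatrix k g n j
  have hQP : Q * P = 1 := by
    rw [← Matrix.mul_kronecker_mul, ← Matrix.map_mul, hinv, Matrix.map_one _ (map_zero c) (map_one c),
      one_mul, Matrix.one_kronecker_one]
  have hL : pencilEval A n = 1 - P * (Z * Q) := by
    rw [pencilEval, Matrix.sum_mul, Matrix.mul_sum]
    congr 1
    refine Finset.sum_congr rfl fun j _ => ?_
    rw [← Matrix.mul_kronecker_mul, ← Matrix.mul_kronecker_mul, one_mul, mul_one, ← Matrix.map_mul,
      ← Matrix.map_mul, ← Matrix.mul_assoc, ← hA]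
  -- The change of basis runs between different index types, so conjugation is replaced by `det (1 -
  -- P Y) = det (1 - Y P)`.
  have hdet : (pencilEval A n).det = (1 - Z).det := by
    rw [hL, Matrix.det_one_sub_mul_comm, Matrix.mul_assoc, hQP, Matrix.mul_one]
  rw [hdet, ← Matrix.det_submatrix_equiv_self (Equiv.sumProdDistrib _ _ (Fin n)).symm]
  have hblock : (1 - Z).submatrix (Equiv.sumProdDistrib _ _ (Fin n)).symm
      (Equiv.sumProdDistrib _ _ (Fin n)).symm = Matrix.fromBlocks
        (pencilEval (restrictTuple A hW) n) (- ∑ j, (B j).map c ⊗ₖ genericMatrix k g n j) 0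
        (pencilEval (quotientTuple A hW) n) := by
    ext1 u v
    rcases u with ⟨p, r⟩ | ⟨p, r⟩ <;> rcases v with ⟨q, s⟩ | ⟨q, s⟩ <;>
      simp [Z, N, pencilEval, Matrix.sub_apply, Matrix.sum_apply, Matrix.one_apply, c]
  rw [hblock, Matrix.det_fromBlocks_zero₂₁]

theorem repr_words_restrict (w : List (Fin g)) (v : W) :
    ∃ h : (w.map A).prod.mulVec v ∈ W, (Module.finBasis k W).repr ⟨_, h⟩
      = (w.map (restrictTuple A hW)).prod.mulVec ((Module.finBasis k W).repr v) := by
  induction w with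
  | nil => simp
  | cons j w ih =>
    obtain ⟨h, hr⟩ := ih
    have hcons : (List.map A (j :: w)).prod.mulVec (v : Fin d → k)
        = Matrix.toLin' (A j) ((w.map A).prod.mulVec v) := by
      simp [← Matrix.mulVec_mulVec]
    have hmem : (List.map A (j :: w)).prod.mulVec (v : Fin d → k) ∈ W := by
      rw [hcons]
      exact hW j h
    have hsub : (⟨_, hmem⟩ : W) = (Matrix.toLin' (A j)).restrict (hW j) ⟨_, h⟩ := Subtype.ext hcons
    refine ⟨hmem, ?_⟩
    rw [hsub, List.map_cons, List.prod_cons, ← Matrix.mulVec_mulVec, ← hr, restrictTuple,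
      LinearMap.toMatrix_mulVec_repr]

theorem words_mulVec_eq_zero {w : List (Fin g)} (h : (w.map (restrictTuple A hW)).prod = 0)
    {v : Fin d → k} (hv : v ∈ W) : (w.map A).prod.mulVec v = 0 := by
  obtain ⟨h', hr⟩ := repr_words_restrict hW w ⟨v, hv⟩
  rw [h, Matrix.zero_mulVec] at hr
  have h0 : (Module.finBasis k W).repr ⟨(w.map A).prod.mulVec v, h'⟩ = 0 := DFunLike.coe_injective hr
  rw [LinearEquiv.map_eq_zero_iff] at h0
  exact congrArg Subtype.val h0

theorem repr_words_quotient (w : List (Fin g)) (v : Fin d → k) :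
    ((Module.finBasis k ((Fin d → k) ⧸ W)).repr (W.mkQ ((w.map A).prod.mulVec v)) : _ → k)
      = (w.map (quotientTuple A hW)).prod.mulVec
        ((Module.finBasis k ((Fin d → k) ⧸ W)).repr (W.mkQ v)) := by
  induction w with
  | nil => simp
  | cons j w ih =>
    rw [List.map_cons, List.prod_cons, List.map_cons, List.prod_cons, ← Matrix.mulVec_mulVec,
      ← Matrix.mulVec_mulVec, ← ih, quotientTuple, LinearMap.toMatrix_mulVec_repr]
    simp

theorem words_mulVec_mem {w : List (Fin g)} (h : (w.map (quotientTuple A hW)).prod = 0)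
    (v : Fin d → k) : (w.map A).prod.mulVec v ∈ W := by
  have hr := repr_words_quotient hW w v
  rw [h, Matrix.zero_mulVec] at hr
  have h0 : (Module.finBasis k ((Fin d → k) ⧸ W)).repr (W.mkQ ((w.map A).prod.mulVec v)) = 0 :=
    DFunLike.coe_injective hr
  rw [LinearEquiv.map_eq_zero_iff] at h0
  exact (Submodule.Quotient.mk_eq_zero W).mp h0

end Invariant

/-! ### The pencil half of the theorem and the numerical bounds. -/

section Atoms

variable {k : Type*} [Field k] {g d : ℕ}

theorem not_isUnit_monicPencil {A : Fin g → Matrix (Fin d) (Fin d) k} {n : ℕ}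
    (h : ¬ IsUnit (pencilEval A n).det) : ¬ IsUnit (monicPencil A) := by
  intro hu
  apply h
  let ev := (Matrix.compRingEquiv (Fin d) (Fin n) (MvPolynomial (Fin g × Fin n × Fin n) k)).toRingHom.comp
    (FreeAlgebra.lift k (genericMatrix k g n)).toRingHom.mapMatrix
  have hev : pencilEval A n = ev (monicPencil A) := by
    ext1 ⟨p, r⟩ ⟨q, s⟩
    exact pencilEval_apply A n p q r s
  rw [hev, ← Matrix.isUnit_iff_isUnit_det]
  exact hu.map ev

/-- A monic pencil of size `d` with an irreducible determinant on `n × n` matrices is an atom if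
`n ≥ 2 (d - 2)`. -/
theorem isMatrixAtom_of_irreducible_det {A : Fin g → Matrix (Fin d) (Fin d) k} {n : ℕ} (hn : 1 ≤ n)
    (hnd : 2 * (d - 2) ≤ n) (h : Irreducible (pencilEval A n).det) :
    IsMatrixAtom (monicPencil A) := by
  refine ⟨isRegular_monicPencil A, not_isUnit_monicPencil h.not_isUnit, ?_⟩
  rintro ⟨F, G, hF, hG, hFG⟩
  have hW : ∀ j, constRange F ≤ (constRange F).comap (Matrix.toLin' (A j)) :=
    fun j v hv => mulVec_mem_constRange hFG j hv
  have hres : ∀ N : ℕ, ¬ ∀ w : List (Fin g), w.length = N →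
      (w.map (restrictTuple A hW)).prod = 0 := fun N hN =>
    hG (isUnit_right_of_words_eq_zero hFG fun w hw v hv => words_mulVec_eq_zero hW (hN w hw) hv)
  have hquo : ∀ N : ℕ, ¬ ∀ w : List (Fin g), w.length = N →
      (w.map (quotientTuple A hW)).prod = 0 := fun N hN =>
    hF (isUnit_left_of_words_mem hFG fun w hw v => words_mulVec_mem hW (hN w hw) v)
  have hdim := Submodule.finrank_quotient_add_finrank (constRange F)
  rw [Module.finrank_fin_fun] at hdim
  -- On a zero space even the empty word acts as zero. Nonzero subspace and quotient both have
  -- dimension at most `d - 1`, which is what `2 * (d - 2) ≤ n` needs.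
  have hp : Module.finrank k (constRange F) ≠ 0 := by
    intro h0
    refine hres 0 fun w _ => ?_
    ext i
    exact absurd i.2 (by omega)
  have hq : Module.finrank k ((Fin d → k) ⧸ constRange F) ≠ 0 := by
    intro h0
    refine hquo 0 fun w _ => ?_
    ext i
    exact absurd i.2 (by omega)
  rcases h.isUnit_or_isUnit (det_pencilEval_eq_mul hW n) with hu | hu
  · obtain ⟨N, hN⟩ := exists_words_eq_zero_of_isUnit_det _ hn (by omega) hu
    exact hres N hN
  · obtain ⟨N, hN⟩ := exists_words_eq_zero_of_isUnit_det _ hn (by omega) hu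
    exact hquo N hN

theorem le_two_mul_of_n₁_le {δ n : ℕ} (h : n₁ δ ≤ n) : δ ≤ 2 * n := by
  have h1 : (δ : ℝ) / 2 ≤ n := Nat.ceil_le.mp h
  have h2 : (δ : ℝ) ≤ ((2 * n : ℕ) : ℝ) := by push_cast; linarith
  exact_mod_cast h2

theorem two_mul_sub_two_le_n₂ {d : ℕ} (hd : 1 < d) : 1 ≤ n₂ d ∧ 2 * (d - 2) ≤ n₂ d := by
  by_cases h2 : d = 2
  · subst h2
    simp [n₂]
  obtain ⟨m, rfl⟩ : ∃ m, d = m + 3 := ⟨d - 3, by omega⟩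
  have hm : (0 : ℝ) ≤ m := Nat.cast_nonneg m
  have key : 2 * (m + 1) ≤ n₂ (m + 3) := by
    rw [n₂, if_neg h2]
    -- The radicand is at least `2 + 1/4 = 9/4`, and `3/2` is just enough: `(d - 1) * 3/2 + (d -
    -- 1)/2 - 2 = 2 (d - 2)`.
    have hsqrt : (3 / 2 : ℝ) ≤ Real.sqrt (2 * (((m + 3 : ℕ) : ℝ) - 1) ^ 2 / (((m + 3 : ℕ) : ℝ) - 2)
        + 1 / 4) := by
      refine Real.le_sqrt_of_sq_le ?_
      have : (2 : ℝ) ≤ 2 * (((m + 3 : ℕ) : ℝ) - 1) ^ 2 / (((m + 3 : ℕ) : ℝ) - 2) := by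
        push_cast
        rw [le_div_iff₀ (by linarith)]
        nlinarith
      linarith
    have hreal : ((2 * (m + 1) : ℕ) : ℝ) ≤ (((m + 3 : ℕ) : ℝ) - 1) *
        Real.sqrt (2 * (((m + 3 : ℕ) : ℝ) - 1) ^ 2 / (((m + 3 : ℕ) : ℝ) - 2) + 1 / 4)
        + (((m + 3 : ℕ) : ℝ) - 1) / 2 - 2 := by
      have hmul := mul_le_mul_of_nonneg_left hsqrt
        (show (0 : ℝ) ≤ ((m + 3 : ℕ) : ℝ) - 1 by push_cast; linarith)
      refine le_trans ?_ (sub_le_sub_right (add_le_add_left hmul _) 2)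
      push_cast
      linarith
    exact_mod_cast hreal.trans (Nat.le_ceil _)
  constructor <;> omega

end Atoms

end FreeLocus

end

theorem proposition4p5 {k : Type*} [Field k] [IsAlgClosed k] [CharZero k] (g : ℕ) :
    (∀ (δ : ℕ), 1 < δ → ∀ f : FreeAlgebra k (Fin g),
      FreeLocus.ncDegree f = δ →
      FreeAlgebra.lift k (fun _ : Fin g => (0 : k)) f = 1 →
      (∃ n : ℕ, FreeLocus.n₁ δ ≤ n ∧ Irreducible (FreeLocus.polyEval f n).det) →
      FreeLocus.IsPolyAtom f) ∧
    (∀ (d : ℕ), 1 < d → ∀ A : Fin g → Matrix (Fin d) (Fin d) k,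
      (∃ n : ℕ, FreeLocus.n₂ d ≤ n ∧ Irreducible (FreeLocus.pencilEval A n).det) →
      FreeLocus.IsMatrixAtom (FreeLocus.monicPencil A)) := by
  refine ⟨?_, ?_⟩
  · rintro δ hδ f rfl - ⟨n, hn, h⟩
    exact FreeLocus.isPolyAtom_of_irreducible_det hδ (FreeLocus.le_two_mul_of_n₁_le hn) h
  · rintro d hd A ⟨n, hn, h⟩
    have hb := FreeLocus.two_mul_sub_two_le_n₂ hd
    exact FreeLocus.isMatrixAtom_of_irreducible_det (hb.1.trans hn) (hb.2.trans hn) h
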